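/- **Setting.** Let $(\Omega,\theta,\mathbb P)$ be an invertible ergodic probability-measure-preserving system. Let $X$ be a compact metric space with the Besicovitch covering property: there are $N\in\mathbb N$ and $\kappa>1$ for which there do not exist points $c_0,\dots,c_N\in X$ and radii $s_0,\dots,s_N>0$ such that (a) for all $i\ne j$, either $s_i\le d(c_i,c_j)$ and $s_j\le\kappa s_i$, or $s_j\le d(c_i,c_j)$ and $s_i\le\kappa s_j$; and (b) for all $i<N$, $s_i\le d(c_i,c_N)\le s_i+s_N$ and $s_N\le\kappa s_i$. (Every compact subset of a finite-dimensional normed space has this property.) Let $X_\omega\subset X$ ($\omega\in\Omega$) be such that $\mathcal E=\{(\omega,x):x\in X_\omega\}$ is measurable, and let $f_\omega:X_\omega\to X_{\theta\omega}$ be maps such that $(\omega,x)\mapsto f_\omega(x)$ is measurable on $\mathcal E$. Put $f_\omega^k=f_{\theta^{k-1}\omega}\circ\dots\circ f_{\theta\omega}\circ f_\omega$. Let $\nu$ be a probability measure on $\mathcal E$, with marginal $\mathbb P$ on $\Omega$, invariant under $S(\omega,x)=(\theta\omega,f_\omega x)$; let $d\nu(\omega,x)=d\mu_\omega(x)\,d\mathbb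 P(\omega)$ be its disintegration and $\mu=\int\mu_\omega\,d\mathbb P$ its marginal on $X$. For measurable $A\subset X$ let $\tau_A^\omega(x)=\inf\{k\ge1: f_\omega^k(x)\in A\}\in\mathbb N\cup\{\infty\}$. $B(x,r)$ denotes a ball, $\mathrm{Lip}(\varphi)$ the Lipschitz constant of $\varphi$. **Theorem.** Assume that there are constants $C_0$, $c$, $d_0,a,b>0$ and $p\in(0,1]$, a random variable $C\in L^p(\Omega,\mathbb P)$, and a sequence $\gamma(\ell)$ with $\ell^k\gamma(\ell)\to0$ for every $k$, such that: (I') for all $\ell\ge1$, all Lipschitz $\varphi:X\to\mathbb R$ and all bounded measurable $\psi:X\to\mathbb R$, $$\Big|\int_\Omega\int_X\varphi\,(\psi\circ f_\omega^\ell)\,d\mu_\omega\,d\mathbb P(\omega)-\int_X\varphi\,d\mu\int_X\psi\,d\mu\Big|\le C_0\,\gamma(\ell)\,\mathrm{Lip}(\varphi)\sup|\psi|;$$ (II') $\liminf_{r\to0}\frac{\log\mu(B(x,r))}{\log r}>d_0$ for $\nu$-a.e. $(\omega,x)$, and, for $\mathbb P$-a.e. $\omega$, $\mu_\omega(B(x,r))\le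 c\,r^{d_0}$ for all $x\in X$, $r>0$; (III') for $\mathbb P$-a.e. $\omega$, for all $\ell\ge1$, all Lipschitz $\varphi$ and all bounded measurable $\psi$, $$\Big|\int_X\varphi\,(\psi\circ f_\omega^\ell)\,d\mu_\omega-\int_X\varphi\,d\mu_\omega\int_X\psi\,d\mu_{\theta^\ell\omega}\Big|\le C(\omega)\,\gamma(\ell)\,\mathrm{Lip}(\varphi)\sup|\psi|;$$ (IV') $\mu(B(x,r+\rho))\le\mu(B(x,r))+r^{-b}\rho^a$ for all $x\in X$ and $r,\rho>0$; (V') $\nu\{(\omega,x)\in\mathcal E:\exists n\ge1,\ f_\omega^n x=x\}=0$. Then for $\mu$-a.e. $y\in X$ there are random variables $\Delta_r$ ($r>0$) on $\Omega$ such that $\Delta_r\to0$ in probability as $r\to0$ and, for all $r>0$ and $\omega\in\Omega$, $$\sup_{t\ge0}\Big|\mu_\omega\Big(x\in X:\tau^\omega_{B(y,r)}(x)>\frac{t}{\mu(B(y,r))}\Big)-e^{-t}\Big|\le\Delta_r(\omega).$$ -/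

import Mathlib

open MeasureTheory ProbabilityTheory Filter Topology
open scoped ENNReal NNReal

noncomputable section

/-- A measurable random dynamical system on `X` over an invertible base map `θ` of `Ω`: fibres
`X_ω ⊆ X` and maps `f_ω : X_ω → X_{θ ω}`. The maps are given as total functions `f ω : X → X`;
their values outside `X_ω` play no role (all measures considered live on the fibres). -/
structure RandomSystem (Ω X : Type*) [MeasurableSpace Ω] [MeasurableSpace X] where
  /-- the invertible base transformation -/
  θ : Ω ≃ᵐ Ω
  /-- the fibre `X_ω` -/
  fiber : Ω → Set X
  /-- the fibre map `f_ω` -/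
  f : Ω → X → X
  measurableSet_graph : MeasurableSet {z : Ω × X | z.2 ∈ fiber z.1}
  mapsTo : ∀ ω, Set.MapsTo (f ω) (fiber ω) (fiber (θ ω))
  measurable_f : Measurable
    ({z : Ω × X | z.2 ∈ fiber z.1}.domRestrict fun z => f z.1 z.2)

namespace RandomSystem

variable {Ω X : Type*} [MeasurableSpace Ω] [MeasurableSpace X] (R : RandomSystem Ω X)

/-- The total space `𝓔 = {(ω, x) : x ∈ X_ω}`. -/
def graph : Set (Ω × X) := {z | z.2 ∈ R.fiber z.1}

/-- The skew product `S (ω, x) = (θ ω, f_ω x)`. -/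
def skew (z : Ω × X) : Ω × X := (R.θ z.1, R.f z.1 z.2)

/-- The composition `f_ω^k = f_{θ^{k-1} ω} ∘ ⋯ ∘ f_{θ ω} ∘ f_ω`. -/
def iter : ℕ → Ω → X → X
  | 0, _, x => x
  | k + 1, ω, x => R.f (R.θ^[k] ω) (iter k ω x)

/-- The hitting time `τ_A^ω(x)`: the first `k ≥ 1` with `f_ω^k x ∈ A` (`⊤` if there is none). -/
def hitTime (A : Set X) (ω : Ω) (x : X) : ℕ∞ :=
  ⨅ (k : ℕ) (_ : 1 ≤ k ∧ R.iter k ω x ∈ A), (k : ℕ∞)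

/-- `ν` is a probability measure on `𝓔` that is invariant under the skew product. -/
structure IsInvariantProb (ν : Measure (Ω × X)) : Prop where
  isProb : IsProbabilityMeasure ν
  supported : ν R.graphᶜ = 0
  invariant : ν.map R.skew = ν

/-- Random aperiodicity: almost no point of `𝓔` is periodic. -/
def RandomAperiodic (ν : Measure (Ω × X)) : Prop :=
  ν {z | z ∈ R.graph ∧ ∃ n : ℕ, 1 ≤ n ∧ R.iter n z.1 z.2 = z.2} = 0

end RandomSystem

/-- `γ(ℓ)` goes to zero faster than any power of `ℓ`. -/
def SuperPolyDecay (γ : ℕ → ℝ) : Prop :=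
  ∀ k : ℕ, Tendsto (fun ℓ : ℕ => (ℓ : ℝ) ^ k * γ ℓ) atTop (𝓝 0)

section Metric

variable {Ω X : Type*} [MeasurableSpace Ω] [MetricSpace X] [MeasurableSpace X]

/-- Annealed decay of correlations, Lipschitz against bounded measurable observables, at rate
`C₀ γ(ℓ)`, for the sample measures `κ ω` and their average `μ`. -/
def AnnealedDecay (R : RandomSystem Ω X) (P : Measure Ω) (κ : Kernel Ω X) (μ : Measure X)
    (C₀ : ℝ) (γ : ℕ → ℝ) : Prop :=
  ∀ (ℓ : ℕ) (φ ψ : X → ℝ) (L : ℝ≥0) (M : ℝ), 1 ≤ ℓ → LipschitzWith L φ → Measurable ψ →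
    (∀ x, |ψ x| ≤ M) →
    |(∫ ω, ∫ x, φ x * ψ (R.iter ℓ ω x) ∂(κ ω) ∂P) - (∫ x, φ x ∂μ) * ∫ x, ψ x ∂μ|
      ≤ C₀ * γ ℓ * L * M

/-- Fibered decay of correlations, Lipschitz against bounded measurable observables, at rate
`C(ω) γ(ℓ)`. -/
def FiberedDecay (R : RandomSystem Ω X) (P : Measure Ω) (κ : Kernel Ω X)
    (C : Ω → ℝ) (γ : ℕ → ℝ) : Prop :=
  ∀ᵐ ω ∂P, ∀ (ℓ : ℕ) (φ ψ : X → ℝ) (L : ℝ≥0) (M : ℝ), 1 ≤ ℓ → LipschitzWith L φ →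
    Measurable ψ → (∀ x, |ψ x| ≤ M) →
    |(∫ x, φ x * ψ (R.iter ℓ ω x) ∂(κ ω)) - (∫ x, φ x ∂(κ ω)) * ∫ x, ψ x ∂(κ (R.θ^[ℓ] ω))|
      ≤ C ω * γ ℓ * L * M

/-- The lower local dimension `liminf_{r → 0} log μ(B(x,r)) / log r`, as an extended real. -/
def lowerLocalDim (μ : Measure X) (x : X) : EReal :=
  liminf (fun r : ℝ => ENNReal.log (μ (Metric.ball x r)) / ((Real.log r : ℝ) : EReal)) (𝓝[>] 0)

/-- `μ_ω(B(x,r)) ≤ c r^{d₀}` uniformly in `x`, `r` and (almost every) `ω`. -/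
def UniformBallBound (P : Measure Ω) (κ : Kernel Ω X) (c d₀ : ℝ) : Prop :=
  ∀ᵐ ω ∂P, ∀ (x : X) (r : ℝ), 0 < r → (κ ω).real (Metric.ball x r) ≤ c * r ^ d₀

/-- Regularity of the measure of annuli:
`μ(B(x,r+ρ)) ≤ μ(B(x,r)) + r^{-b} ρ^a`. -/
def AnnulusRegular (μ : Measure X) (a b : ℝ) : Prop :=
  ∀ (x : X) (r ρ : ℝ), 0 < r → 0 < ρ →
    μ.real (Metric.ball x (r + ρ)) ≤ μ.real (Metric.ball x r) + r ^ (-b) * ρ ^ a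

end Metric

end

/-!
# The quenched exponential law for hitting times of small balls

Fix a ball `A = B(y, r)`, put `ε = μ A` and `a ω = κ ω A`, and let `V n ω` be the `κ ω`-probability
that the orbit avoids `A` at the times `1, …, n`. Equivariance of the sample measures gives
`V (n + 1) ω = V n (θ ω) - κ (θ ω) (A ∩ {no visit up to n})`. If starting in `A` were independent of
avoiding `A` later, the last term would be `a (θ ω) * V n (θ ω)`, and `V n ω` would be close to
`exp (-∑ i ≤ n, a (θ^i ω))`; the total error of this comparison is at most `n` times the mean defect
of independence (`integral_abs_real_noHit_sub_exp_le`). The defect is controlled by leaving a gap of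
length `g`: fibered decay of correlations applies after the gap, at the price of an annulus in which
the indicator of `A` is smoothed, and what happens during the gap is a short return to `A`
(`FiberedDecay.integral_abs_inter_noHit_sub_le`). The random constant is only in `L^p` with `p ≤ 1`,
but the defect is at most `1`, so the error `C ω * w` may be replaced by `|C ω| ^ p * w ^ p`.

The sums `∑ i ≤ n, a (θ^i ω)` concentrate around `n ε` by a variance computation
(`integral_sq_sum_iterate_le`): the fibered and annealed decays together make `a` and `a ∘ θ^ℓ`
nearly uncorrelated for `ℓ ≥ g`, and the uniform bound `a ≤ c r ^ d₀` takes care of the lags below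
`g`.

Short returns are rare around almost every `y`. By the annealed decay and Borel-Cantelli the distance
from `x` to `f_ω^ℓ x` is eventually at least a fixed negative power of `ℓ`, and by aperiodicity it
does not vanish for the first times; hence the recurrence constant
`inf_ℓ ℓ ^ β * dist (f_ω^ℓ x) x` is almost surely positive. A return to `A` before time `r ^ (-δ)`
forces this constant to be small, and the Besicovitch differentiation theorem bounds the conditional
probability of that event given `x ∈ B(y, r)`
(`RandomSystem.IsStationary.ae_eventually_short_return_le`).

The superpolynomial decay has to beat `1 / ε`, so `ε` must not be smaller than all powers of `r`.
This follows from the Besicovitch covering property: balls of equal radius `s` with centres at mutual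
distances in `[s, 2s]` form a satellite configuration, so the space is doubling, and a finite measure
on a compact doubling space has finite upper local dimension almost everywhere
(`exists_eventually_pow_le_measure_ball`).

All this is done for one rescaled time `t`, with convergence in mean. Since `V` is nonincreasing and
its limit is continuous, finitely many `t` suffice for uniformity (`abs_sub_exp_le_of_antitone`). The
fibre maps are measurable on the total space only; extending them by the identity reduces the
problem to everywhere measurable maps (`RandomSystem.totalize`).
-/

/-! ### The Besicovitch covering property forces doubling -/

section Doubling

variable {X : Type*} [MetricSpace X]

/-- Balls of a common radius `s` whose centres have pairwise distances in `[s, 2s]` form a satellite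
configuration, so the number of such centres is bounded. -/
lemma exists_card_le_of_dist_mem_Icc [HasBesicovitchCovering X] :
    ∃ N : ℕ, ∀ (s : ℝ) (F : Finset X), 0 < s →
      (F : Set X).Pairwise (fun x y => s ≤ dist x y ∧ dist x y ≤ 2 * s) → F.card ≤ N := by
  obtain ⟨N, τ, hτ, he⟩ := HasBesicovitchCovering.no_satelliteConfig (α := X)
  refine ⟨N, fun s F hs hF => ?_⟩
  by_contra! hcard
  obtain ⟨G, hGF, hG⟩ := Finset.exists_subset_card_eq (Nat.succ_le_of_lt hcard)
  let e := (G.equivFinOfCardEq hG).symm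
  have hdist : ∀ i j, i ≠ j →
      s ≤ dist (e i : X) (e j) ∧ dist (e i : X) (e j) ≤ 2 * s := fun i j hij =>
    hF (hGF (e i).2) (hGF (e j).2) fun h => hij (e.injective (Subtype.ext h))
  have hsτ : s ≤ τ * s := by nlinarith
  exact he.elim
    { c := fun i => (e i : X)
      r := fun _ => s
      rpos := fun _ => hs
      h := fun i j hij => Or.inl ⟨(hdist i j hij).1, hsτ⟩
      hlast := fun i hi => ⟨(hdist i _ hi.ne).1, hsτ⟩
      inter := fun i hi => by
        have := (hdist i _ hi.ne).2
        linarith }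

lemma exists_maximal_separated_subset (F : Finset X) {s : ℝ} (hs : 0 < s) :
    ∃ G ⊆ F, (G : Set X).Pairwise (fun x y => s ≤ dist x y) ∧ ∀ x ∈ F, ∃ g ∈ G, dist x g < s := by
  classical
  induction F using Finset.induction_on with
  | empty => exact ⟨∅, by simp⟩
  | insert x F hx ih =>
    obtain ⟨G, hGF, hG, hcov⟩ := ih
    by_cases h : ∃ g ∈ G, dist x g < s
    · refine ⟨G, hGF.trans (Finset.subset_insert _ _), hG, fun y hy => ?_⟩
      rcases Finset.mem_insert.1 hy with rfl | hy
      · exact h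
      · exact hcov y hy
    · push Not at h
      refine ⟨insert x G, Finset.insert_subset_insert _ hGF, ?_, fun y hy => ?_⟩
      · rw [Finset.coe_insert]
        refine hG.insert fun g hg _ => ⟨h g hg, ?_⟩
        rw [dist_comm]
        exact h g hg
      · rcases Finset.mem_insert.1 hy with rfl | hy
        · exact ⟨y, Finset.mem_insert_self _ _, by simpa using hs⟩
        · obtain ⟨g, hg, hyg⟩ := hcov y hy
          exact ⟨g, Finset.mem_insert_of_mem hg, hyg⟩

lemma card_le_mul_of_cover {F G : Finset X} {s : ℝ} (n : ℕ)
    (hcov : ∀ x ∈ F, ∃ g ∈ G, dist x g < s)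
    (hn : ∀ g ∈ G, (F.filter fun x => dist x g < s).card ≤ n) : F.card ≤ G.card * n := by
  classical
  have hsub : F ⊆ G.biUnion fun g => F.filter fun x => dist x g < s := fun x hx => by
    obtain ⟨g, hg, hxg⟩ := hcov x hx
    exact Finset.mem_biUnion.2 ⟨g, hg, Finset.mem_filter.2 ⟨hx, hxg⟩⟩
  exact (Finset.card_le_card hsub).trans (Finset.card_biUnion_le_card_mul _ _ _ hn)

/-- A Ramsey-type argument: among the points of an `s`-separated set of diameter at most `4s`, both
the `2s`-separated subsets and the subsets of diameter at most `2s` are of bounded size, hence so is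
the whole set. -/
lemma exists_card_le_of_separated_of_dist_le [HasBesicovitchCovering X] :
    ∃ M : ℕ, ∀ (s : ℝ) (F : Finset X), 0 < s → (F : Set X).Pairwise (fun x y => s ≤ dist x y) →
      (∀ x ∈ F, ∀ y ∈ F, dist x y ≤ 4 * s) → F.card ≤ M := by
  classical
  obtain ⟨N, hN⟩ := exists_card_le_of_dist_mem_Icc (X := X)
  have key : ∀ k : ℕ, ∃ M : ℕ, ∀ (s : ℝ) (F : Finset X), 0 < s →
      (F : Set X).Pairwise (fun x y => s ≤ dist x y) → (∀ x ∈ F, ∀ y ∈ F, dist x y ≤ 4 * s) →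
      (∀ G ⊆ F, (G : Set X).Pairwise (fun x y => dist x y ≤ 2 * s) → G.card ≤ k) →
      F.card ≤ M := by
    intro k
    induction k with
    | zero =>
      refine ⟨0, fun s F hs hF _ hG => ?_⟩
      by_contra! hcard
      obtain ⟨x, hx⟩ := Finset.card_pos.1 hcard
      have := hG {x} (by simpa using hx) (by simp)
      simp at this
    | succ k ih =>
      obtain ⟨M, hM⟩ := ih
      refine ⟨N * (M + 1), fun s F hs hF hdiam hclose => ?_⟩
      obtain ⟨G, hGF, hG, hcov⟩ := exists_maximal_separated_subset F (s := 2 * s) (by positivity)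
      have hGN : G.card ≤ N := by
        refine hN (2 * s) G (by positivity) fun x hx y hy hxy => ⟨hG hx hy hxy, ?_⟩
        have := hdiam x (hGF hx) y (hGF hy)
        linarith
      refine (card_le_mul_of_cover (M + 1) hcov fun g hg => ?_).trans
        (Nat.mul_le_mul_right _ hGN)
      set F' := (F.filter fun x => dist x g < 2 * s).erase g with hF'
      have hF'F : F' ⊆ F := (Finset.erase_subset _ _).trans (Finset.filter_subset _ _)
      have hcard : F'.card ≤ M := by
        refine hM s F' hs (hF.mono (by exact_mod_cast hF'F))
          (fun x hx y hy => hdiam x (hF'F hx) y (hF'F hy)) fun H hH hHc => ?_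
        have hgH : g ∉ H := fun h => by simpa [hF'] using hH h
        have := hclose (insert g H) (Finset.insert_subset (hGF hg) (hH.trans hF'F)) ?_
        · rw [Finset.card_insert_of_notMem hgH] at this
          omega
        · rw [Finset.coe_insert]
          refine hHc.insert fun h hh _ => ?_
          have hlt : dist h g < 2 * s :=
            (Finset.mem_filter.1 (Finset.mem_of_mem_erase (hH hh))).2
          exact ⟨by rw [dist_comm]; exact hlt.le, hlt.le⟩
      have : (F.filter fun x => dist x g < 2 * s).card - 1 ≤ F'.card :=
        Finset.pred_card_le_card_erase
      omega
  obtain ⟨M, hM⟩ := key N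
  refine ⟨M, fun s F hs hF hdiam => hM s F hs hF hdiam fun G hGF hG => ?_⟩
  exact hN s G hs fun x hx y hy hxy => ⟨hF (hGF hx) (hGF hy) hxy, hG hx hy hxy⟩

/-- The doubling property, with the doubling constant written as `2 ^ D` so that `D` bounds the
dimension: an `s`-separated set in a ball of radius `2 ^ m * s` has at most `2 ^ (D * (m + 1))`
points. -/
lemma exists_card_le_of_separated_of_subset_ball [HasBesicovitchCovering X] :
    ∃ D : ℕ, ∀ (m : ℕ) (s : ℝ) (x : X) (F : Finset X), 0 < s →
      (F : Set X).Pairwise (fun x y => s ≤ dist x y) → (∀ y ∈ F, dist y x < 2 ^ m * s) →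
      F.card ≤ 2 ^ (D * (m + 1)) := by
  classical
  obtain ⟨M, hM⟩ := exists_card_le_of_separated_of_dist_le (X := X)
  have hMD : M ≤ 2 ^ M := Nat.lt_two_pow_self.le
  have hball : ∀ (s : ℝ) (x : X) (F : Finset X), 0 < s →
      (F : Set X).Pairwise (fun x y => s ≤ dist x y) → (∀ y ∈ F, dist y x < 2 * s) →
      F.card ≤ 2 ^ M := by
    refine fun s x F hs hF hx => (hM s F hs hF fun y hy z hz => ?_).trans hMD
    have h1 := hx y hy
    have h2 := hx z hz
    have h3 := dist_triangle_right y z x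
    linarith
  refine ⟨M, fun m => ?_⟩
  induction m with
  | zero =>
    intro s x F hs hF hx
    simpa using hball s x F hs hF fun y hy => by
      have := hx y hy
      simp only [pow_zero] at this
      linarith
  | succ m ih =>
    intro s x F hs hF hx
    have hpos : 0 < 2 ^ m * s := by positivity
    obtain ⟨G, hGF, hG, hcov⟩ := exists_maximal_separated_subset F hpos
    have hGc := hball (2 ^ m * s) x G hpos hG fun y hy => by
      have := hx y (hGF hy)
      rw [pow_succ] at this
      linarith
    have := card_le_mul_of_cover (2 ^ (M * (m + 1))) hcov fun g _ =>
      ih s g _ hs (hF.mono (by exact_mod_cast Finset.filter_subset _ _)) fun y hy =>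
        (Finset.mem_filter.1 hy).2
    calc F.card ≤ G.card * 2 ^ (M * (m + 1)) := this
      _ ≤ 2 ^ M * 2 ^ (M * (m + 1)) := Nat.mul_le_mul_right _ hGc
      _ = 2 ^ (M * (m + 1 + 1)) := by rw [← pow_add]; ring_nf

/-- Nets of a compact Besicovitch space: at every scale `r ≤ 1` polynomially many points in `1 / r`
suffice, and their `2r`-balls have bounded overlap. -/
lemma exists_net [CompactSpace X] [HasBesicovitchCovering X] :
    ∃ (M D : ℕ) (B : ℝ), 0 ≤ B ∧ ∀ r : ℝ, 0 < r → r ≤ 1 → ∃ T : Finset X,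
      (∀ x, ∃ t ∈ T, dist x t < r) ∧ (T.card : ℝ) * r ^ D ≤ B ∧
      ∀ x, (T.filter fun t => dist x t < 2 * r).card ≤ M := by
  classical
  obtain ⟨D, hD⟩ := exists_card_le_of_separated_of_subset_ball (X := X)
  rcases isEmpty_or_nonempty X with hX | ⟨⟨x₀⟩⟩
  · exact ⟨0, 0, 0, le_rfl, fun r _ _ => ⟨∅, fun x => hX.elim x, by simp, fun x => hX.elim x⟩⟩
  obtain ⟨R, hR⟩ := (isCompact_univ (X := X)).isBounded.subset_closedBall x₀
  set R₀ := max R 1 with hR₀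
  have hR₀1 : 1 ≤ R₀ := le_max_right _ _
  refine ⟨2 ^ (D * 3), D, (8 * R₀) ^ D, by positivity, fun r hr hr1 => ?_⟩
  have hr2 : 0 < r / 2 := by positivity
  obtain ⟨t, -, htf, htc⟩ := finite_cover_balls_of_compact (isCompact_univ (X := X)) hr2
  obtain ⟨T, -, hTs, hTc⟩ := exists_maximal_separated_subset htf.toFinset hr2
  refine ⟨T, fun x => ?_, ?_, fun x => ?_⟩
  · obtain ⟨y, hy, hxy⟩ := Set.mem_iUnion₂.1 (htc (Set.mem_univ x))
    obtain ⟨g, hg, hyg⟩ := hTc y (htf.mem_toFinset.2 hy)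
    refine ⟨g, hg, ?_⟩
    have h1 := dist_triangle x y g
    have h2 : dist x y < r / 2 := hxy
    linarith
  · -- the least `m` with `2 ^ m * (r / 2) > R₀`
    have hex : ∃ m : ℕ, R₀ < 2 ^ m * (r / 2) := by
      obtain ⟨m, hm⟩ := pow_unbounded_of_one_lt (R₀ / (r / 2)) (one_lt_two (α := ℝ))
      exact ⟨m, (div_lt_iff₀ hr2).1 hm⟩
    have hm := Nat.find_spec hex
    have hmin := fun k => Nat.find_min hex (m := k)
    set m := Nat.find hex
    have hm0 : m ≠ 0 := by
      intro h
      rw [h] at hm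
      norm_num at hm
      linarith
    obtain ⟨k, hk⟩ := Nat.exists_eq_succ_of_ne_zero hm0
    have hk' : 2 ^ k * (r / 2) ≤ R₀ := not_lt.1 (hmin k (by omega))
    have hcard := hD m (r / 2) x₀ T hr2 hTs fun y _ => by
      have h1 : dist y x₀ ≤ R := hR (Set.mem_univ y)
      exact (h1.trans (le_max_left _ _)).trans_lt hm
    calc (T.card : ℝ) * r ^ D ≤ (2 : ℝ) ^ (D * (m + 1)) * r ^ D := by
          gcongr
          exact_mod_cast hcard
      _ = (2 ^ (m + 1) * r) ^ D := by rw [mul_pow, ← pow_mul, mul_comm D]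
      _ ≤ (8 * R₀) ^ D := by
          refine pow_le_pow_left₀ (by positivity) ?_ D
          rw [hk, Nat.succ_eq_add_one, pow_succ, pow_succ]
          linarith
  · refine hD 2 (r / 2) x _ hr2 (hTs.mono (by exact_mod_cast Finset.filter_subset _ _))
      fun y hy => ?_
    have := (Finset.mem_filter.1 hy).2
    rw [dist_comm]
    linarith

/-- A finite measure on a compact Besicovitch space has finite upper local dimension almost
everywhere, with a bound depending on the space only. -/
lemma exists_eventually_pow_le_measure_ball [CompactSpace X] [HasBesicovitchCovering X]
    [MeasurableSpace X] :
    ∃ D : ℕ, ∀ μ : Measure X, IsFiniteMeasure μ →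
      ∀ᵐ y ∂μ, ∀ᶠ r in 𝓝[>] (0 : ℝ), r ^ D ≤ μ.real (Metric.ball y r) := by
  obtain ⟨M, D, B, hB, hnet⟩ := exists_net (X := X)
  refine ⟨D + 2, fun μ _ => ?_⟩
  set ρ : ℕ → ℝ := fun m => (1 / 2) ^ m with hρ
  have hρ0 : ∀ m, 0 < ρ m := fun m => by positivity
  have hρ1 : ∀ m, ρ m ≤ 1 := fun m => pow_le_one₀ (by norm_num) (by norm_num)
  let Y : ℕ → Set X := fun m => {y | μ.real (Metric.ball y (2 * ρ m)) < ρ m ^ (D + 1)}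
  have hY : ∀ m, μ (Y m) ≤ ENNReal.ofReal (B * ρ m) := by
    intro m
    obtain ⟨T, hT, hTB, -⟩ := hnet (ρ m) (hρ0 m) (hρ1 m)
    have hsub : Y m ⊆ ⋃ t ∈ T, Y m ∩ Metric.ball t (ρ m) := fun y hy => by
      obtain ⟨t, ht, hyt⟩ := hT y
      exact Set.mem_iUnion₂.2 ⟨t, ht, hy, hyt⟩
    have hpiece : ∀ t ∈ T, μ (Y m ∩ Metric.ball t (ρ m)) ≤ ENNReal.ofReal (ρ m ^ (D + 1)) := by
      intro t _
      rcases (Y m ∩ Metric.ball t (ρ m)).eq_empty_or_nonempty with h | ⟨y, hy, hyt⟩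
      · simp [h]
      · have hball : Y m ∩ Metric.ball t (ρ m) ⊆ Metric.ball y (2 * ρ m) := by
          rintro z ⟨-, hz⟩
          rw [Metric.mem_ball] at hz hyt ⊢
          have := dist_triangle_right z y t
          linarith
        refine (measure_mono hball).trans ?_
        rw [← ofReal_measureReal]
        exact ENNReal.ofReal_le_ofReal (le_of_lt hy)
    calc μ (Y m) ≤ ∑ t ∈ T, μ (Y m ∩ Metric.ball t (ρ m)) :=
          (measure_mono hsub).trans (measure_biUnion_finset_le _ _)
      _ ≤ ∑ _t ∈ T, ENNReal.ofReal (ρ m ^ (D + 1)) := Finset.sum_le_sum hpiece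
      _ = ENNReal.ofReal (T.card * ρ m ^ (D + 1)) := by
          rw [Finset.sum_const, nsmul_eq_mul, ENNReal.ofReal_mul (by positivity),
            ENNReal.ofReal_natCast]
      _ ≤ ENNReal.ofReal (B * ρ m) := by
          refine ENNReal.ofReal_le_ofReal ?_
          rw [pow_succ, ← mul_assoc]
          exact mul_le_mul_of_nonneg_right hTB (hρ0 m).le
  have hsum : ∑' m, μ (Y m) ≠ ∞ := by
    refine ne_top_of_le_ne_top ?_ (ENNReal.tsum_le_tsum hY)
    rw [← ENNReal.ofReal_tsum_of_nonneg (fun m => by positivity)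
      (summable_geometric_two.mul_left B)]
    exact ENNReal.ofReal_ne_top
  filter_upwards [ae_eventually_notMem hsum] with y hy
  obtain ⟨m₀, hm₀⟩ := eventually_atTop.1 hy
  have hpos : 0 < min (ρ m₀) ((1 / 4) ^ (D + 1)) := lt_min (hρ0 m₀) (by positivity)
  filter_upwards [Ioo_mem_nhdsGT hpos] with r ⟨hr0, hr⟩
  have hrm : r < ρ m₀ := hr.trans_le (min_le_left _ _)
  have hrD : r < (1 / 4) ^ (D + 1) := hr.trans_le (min_le_right _ _)
  -- the dyadic scale `r / 4 < 2 ^ (-m) ≤ r / 2`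
  obtain ⟨n, hn1, hn2⟩ := exists_nat_pow_near_of_lt_one hr0 (hrm.le.trans (hρ1 m₀))
    (by norm_num : (0 : ℝ) < 1 / 2) (by norm_num)
  have hle : 2 * ρ (n + 2) ≤ r := by
    simp only [hρ, pow_succ] at hn1 ⊢
    linarith
  have hge : r / 4 ≤ ρ (n + 2) := by
    simp only [hρ, pow_succ] at hn1 ⊢
    linarith
  have hmn : m₀ ≤ n + 2 := by
    by_contra! h
    have : ρ m₀ ≤ ρ (n + 2) := pow_le_pow_of_le_one (by norm_num) (by norm_num) h.le
    linarith
  have hnot : ρ (n + 2) ^ (D + 1) ≤ μ.real (Metric.ball y (2 * ρ (n + 2))) :=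
    not_lt.1 (hm₀ _ hmn)
  calc r ^ (D + 2) = r ^ (D + 1) * r := pow_succ _ _
    _ ≤ r ^ (D + 1) * (1 / 4) ^ (D + 1) := by gcongr
    _ = (r / 4) ^ (D + 1) := by rw [← mul_pow]; ring
    _ ≤ ρ (n + 2) ^ (D + 1) := by gcongr
    _ ≤ _ := hnot
    _ ≤ μ.real (Metric.ball y r) := measureReal_mono (Metric.ball_subset_ball hle)

end Doubling

/-! ### Measurable random systems and their stationary sample measures -/

namespace RandomSystem

variable {Ω X : Type*} [MeasurableSpace Ω] [MeasurableSpace X]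

/-- The fibre maps are measurable on all of `Ω × X`, the base preserves `P`, and the measure
`P ⊗ κ` is invariant under the skew product. -/
structure IsStationary (R : RandomSystem Ω X) (P : Measure Ω) (κ : Kernel Ω X) : Prop where
  measurable_uncurry : Measurable fun z : Ω × X => R.f z.1 z.2
  base : MeasurePreserving R.θ P P
  invariant : (P.compProd κ).map R.skew = P.compProd κ

/-- The points of the fibre over `ω` whose orbit avoids `A` at the times `1, …, m`. -/
def noHit (R : RandomSystem Ω X) (A : Set X) (m : ℕ) (ω : Ω) : Set X :=
  {x | ∀ k, 1 ≤ k → k ≤ m → R.iter k ω x ∉ A}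

variable {R : RandomSystem Ω X}

lemma iter_add (j k : ℕ) (ω : Ω) (x : X) :
    R.iter (j + k) ω x = R.iter j (R.θ^[k] ω) (R.iter k ω x) := by
  induction j with
  | zero => simp [iter]
  | succ j ih => rw [Nat.succ_add, iter, iter, ih, Function.iterate_add_apply]

lemma iter_succ_eq (k : ℕ) (ω : Ω) (x : X) :
    R.iter (k + 1) ω x = R.iter k (R.θ ω) (R.f ω x) := by
  simpa [iter] using iter_add k 1 ω x

lemma measurable_iterate_base (k : ℕ) : Measurable (R.θ^[k]) := R.θ.measurable.iterate k

lemma noHit_antitone (A : Set X) (ω : Ω) {m n : ℕ} (h : m ≤ n) :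
    R.noHit A n ω ⊆ R.noHit A m ω := fun _ hx k hk hkm => hx k hk (hkm.trans h)

lemma mem_noHit_succ {A : Set X} {m : ℕ} {ω : Ω} {x : X} :
    x ∈ R.noHit A (m + 1) ω ↔ R.f ω x ∉ A ∧ R.f ω x ∈ R.noHit A m (R.θ ω) := by
  constructor
  · refine fun h => ⟨by simpa [iter] using h 1 le_rfl (by omega), fun k hk hkm => ?_⟩
    rw [← iter_succ_eq]
    exact h (k + 1) (by omega) (by omega)
  · rintro ⟨h0, h⟩ k hk hkm
    obtain ⟨j, rfl⟩ := Nat.exists_eq_succ_of_ne_zero (by omega : k ≠ 0)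
    rw [Nat.succ_eq_add_one, iter_succ_eq]
    rcases Nat.eq_zero_or_pos j with rfl | hj
    · simpa [iter] using h0
    · exact h j hj (by omega)

lemma iter_mem_noHit_of_mem {A : Set X} {m g : ℕ} {ω : Ω} {x : X} (h : x ∈ R.noHit A m ω) :
    R.iter g ω x ∈ R.noHit A (m - g) (R.θ^[g] ω) := fun k hk hkm => by
  rw [← iter_add]
  exact h _ (by omega) (by omega)

lemma mem_noHit_of_iter_mem {A : Set X} {m g : ℕ} {ω : Ω} {x : X} (hg : x ∈ R.noHit A g ω)
    (h : R.iter g ω x ∈ R.noHit A (m - g) (R.θ^[g] ω)) : x ∈ R.noHit A m ω := fun k hk hkm => by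
  rcases le_or_gt k g with hkg | hkg
  · exact hg k hk hkg
  · have := h (k - g) (by omega) (by omega)
    rwa [← iter_add, Nat.sub_add_cancel hkg.le] at this

/-- The hitting time exceeds the real number `s ≥ 0` if and only if the set is avoided up to time
`⌊s⌋`. -/
lemma lt_hitTime_iff {A : Set X} {ω : Ω} {x : X} {s : ℝ} (hs : 0 ≤ s) :
    ENNReal.ofReal s < (R.hitTime A ω x : ℝ≥0∞) ↔ x ∈ R.noHit A ⌊s⌋₊ ω := by
  have hlt : ∀ n : ℕ, ENNReal.ofReal s < (n : ℝ≥0∞) ↔ ⌊s⌋₊ < n := fun n => by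
    rw [Nat.floor_lt hs, ← ENNReal.ofReal_natCast n, ENNReal.ofReal_lt_ofReal_iff']
    exact ⟨fun h => h.1, fun h => ⟨h, hs.trans_lt h⟩⟩
  constructor
  · intro h k hk hks hmem
    have hle : R.hitTime A ω x ≤ (k : ℕ∞) := iInf₂_le k ⟨hk, hmem⟩
    have hle' : (R.hitTime A ω x : ℝ≥0∞) ≤ ((k : ℕ∞) : ℝ≥0∞) := ENat.toENNReal_le.2 hle
    rw [ENat.toENNReal_coe] at hle'
    exact absurd ((hlt k).1 (h.trans_le hle')) (by omega)
  · intro h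
    have hle : ((⌊s⌋₊ + 1 : ℕ) : ℕ∞) ≤ R.hitTime A ω x := by
      refine le_iInf₂ fun k hk => ?_
      have : ⌊s⌋₊ < k := by
        by_contra! hks
        exact h k hk.1 hks hk.2
      exact_mod_cast this
    have hle' := ENat.toENNReal_le.2 hle
    rw [ENat.toENNReal_coe] at hle'
    exact ((hlt _).2 (Nat.lt_succ_self _)).trans_le hle'

namespace IsStationary

variable {P : Measure Ω} {κ : Kernel Ω X}

lemma measurable_skew (hR : R.IsStationary P κ) : Measurable R.skew :=
  (R.θ.measurable.comp measurable_fst).prodMk hR.measurable_uncurry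

lemma measurable_iter (hR : R.IsStationary P κ) (k : ℕ) :
    Measurable fun z : Ω × X => R.iter k z.1 z.2 := by
  induction k with
  | zero => exact measurable_snd
  | succ k ih =>
    exact hR.measurable_uncurry.comp
      (((measurable_iterate_base k).comp measurable_fst).prodMk ih)

lemma measurable_iter_right (hR : R.IsStationary P κ) (k : ℕ) (ω : Ω) : Measurable (R.iter k ω) :=
  (hR.measurable_iter k).comp measurable_prodMk_left

lemma measurableSet_noHit_prod (hR : R.IsStationary P κ) {A : Set X} (hA : MeasurableSet A) (m : ℕ) :
    MeasurableSet {z : Ω × X | z.2 ∈ R.noHit A m z.1} := by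
  have : {z : Ω × X | z.2 ∈ R.noHit A m z.1}
      = ⋂ (k : ℕ) (_ : 1 ≤ k) (_ : k ≤ m), (fun z : Ω × X => R.iter k z.1 z.2) ⁻¹' Aᶜ := by
    ext z
    simp [noHit]
  rw [this]
  exact MeasurableSet.iInter fun k => MeasurableSet.iInter fun _ => MeasurableSet.iInter fun _ =>
    hR.measurable_iter k hA.compl

lemma measurableSet_noHit (hR : R.IsStationary P κ) {A : Set X} (hA : MeasurableSet A) (m : ℕ)
    (ω : Ω) :
    MeasurableSet (R.noHit A m ω) :=
  measurable_prodMk_left (hR.measurableSet_noHit_prod hA m)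

lemma base_iterate (hR : R.IsStationary P κ) (k : ℕ) :
    MeasurePreserving (R.θ^[k]) P P := hR.base.iterate k

/-- Equivariance of the sample measures, tested on one measurable set; the invertibility of the base
is what makes the disintegration of the invariant measure equivariant. -/
lemma ae_kernel_skew (hR : R.IsStationary P κ) [IsProbabilityMeasure P] [IsMarkovKernel κ]
    {G : Set (Ω × X)} (hG : MeasurableSet G) :
    ∀ᵐ ω ∂P, κ ω {x | R.skew (ω, x) ∈ G} = κ (R.θ ω) {x | (R.θ ω, x) ∈ G} := by
  have hpre : MeasurableSet (R.skew ⁻¹' G) := hR.measurable_skew hG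
  have m1 : Measurable fun ω => κ ω {x | R.skew (ω, x) ∈ G} :=
    Kernel.measurable_kernel_prodMk_left hpre
  have m2' : Measurable fun ω => κ ω {x | (ω, x) ∈ G} := Kernel.measurable_kernel_prodMk_left hG
  have m2 : Measurable fun ω => κ (R.θ ω) {x | (R.θ ω, x) ∈ G} := m2'.comp R.θ.measurable
  refine ae_eq_of_forall_setLIntegral_eq_of_sigmaFinite m1 m2 fun s hs _ => ?_
  set s' : Set Ω := R.θ.symm ⁻¹' s with hs'
  have hs'm : MeasurableSet s' := R.θ.symm.measurable hs
  have hss' : R.θ ⁻¹' s' = s := by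
    ext ω
    simp [hs']
  have e2 : ∫⁻ ω in s, κ (R.θ ω) {x | (R.θ ω, x) ∈ G} ∂P
      = ∫⁻ ω in s', κ ω {x | (ω, x) ∈ G} ∂P := by
    rw [← hss']
    exact hR.base.setLIntegral_comp_preimage hs'm m2'
  have hind : ∀ (t : Set Ω) (H : Set (Ω × X)), MeasurableSet t → MeasurableSet H →
      ∫⁻ ω in t, κ ω {x | (ω, x) ∈ H} ∂P = (P.compProd κ) ({z | z.1 ∈ t} ∩ H) := by
    intro t H ht hH
    have htH : MeasurableSet ({z : Ω × X | z.1 ∈ t} ∩ H) := (measurable_fst ht).inter hH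
    rw [Measure.compProd_apply htH, ← lintegral_indicator ht]
    refine lintegral_congr fun ω => ?_
    by_cases hω : ω ∈ t <;> simp [hω, Set.preimage]
  have e1 := hind s (R.skew ⁻¹' G) hs hpre
  have e3 := hind s' G hs'm hG
  have hinv : (P.compProd κ) (R.skew ⁻¹' ({z | z.1 ∈ s'} ∩ G))
      = (P.compProd κ) ({z | z.1 ∈ s'} ∩ G) := by
    have hs'G : MeasurableSet ({z : Ω × X | z.1 ∈ s'} ∩ G) := (measurable_fst hs'm).inter hG
    conv_rhs => rw [← hR.invariant]
    rw [Measure.map_apply hR.measurable_skew hs'G]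
  rw [e2, e3, ← hinv]
  refine Eq.trans e1 (congrArg _ ?_)
  ext z
  simp [hs', skew]

lemma ae_kernel_iter (hR : R.IsStationary P κ) [IsProbabilityMeasure P] [IsMarkovKernel κ] (k : ℕ)
    {G : Set (Ω × X)} (hG : MeasurableSet G) :
    ∀ᵐ ω ∂P, κ ω {x | (R.θ^[k] ω, R.iter k ω x) ∈ G} = κ (R.θ^[k] ω) {x | (R.θ^[k] ω, x) ∈ G} := by
  induction k with
  | zero => simp [iter]
  | succ k ih =>
    have hG' : MeasurableSet {z : Ω × X | (R.θ^[k] z.1, R.iter k z.1 z.2) ∈ G} :=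
      (((measurable_iterate_base k).comp measurable_fst).prodMk (hR.measurable_iter k)) hG
    filter_upwards [hR.ae_kernel_skew hG', hR.base.quasiMeasurePreserving.ae ih] with ω h1 h2
    simp only [iter_succ_eq, Function.iterate_succ_apply]
    exact h1.trans h2

lemma ae_kernel_real_iter (hR : R.IsStationary P κ) [IsProbabilityMeasure P] [IsMarkovKernel κ] (k : ℕ)
    {A : Set X} (hA : MeasurableSet A) :
    ∀ᵐ ω ∂P, (κ ω).real {x | R.iter k ω x ∈ A} = (κ (R.θ^[k] ω)).real A := by
  filter_upwards [hR.ae_kernel_iter k (measurable_snd hA)] with ω h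
  exact congrArg ENNReal.toReal h

lemma ae_kernel_real_iter_noHit (hR : R.IsStationary P κ) [IsProbabilityMeasure P]
    [IsMarkovKernel κ] (k m : ℕ) {A : Set X} (hA : MeasurableSet A) :
    ∀ᵐ ω ∂P, (κ ω).real {x | R.iter k ω x ∈ R.noHit A m (R.θ^[k] ω)}
      = (κ (R.θ^[k] ω)).real (R.noHit A m (R.θ^[k] ω)) := by
  filter_upwards [hR.ae_kernel_iter k (hR.measurableSet_noHit_prod hA m)] with ω h
  exact congrArg ENNReal.toReal h

lemma integral_iterate (hR : R.IsStationary P κ) (k : ℕ) (u : Ω → ℝ) (hu : Measurable u) :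
    ∫ ω, u (R.θ^[k] ω) ∂P = ∫ ω, u ω ∂P := by
  have h := hR.base_iterate k
  conv_rhs => rw [← h.map_eq]
  rw [integral_map h.measurable.aemeasurable (hu.aestronglyMeasurable)]

end IsStationary

end RandomSystem

section Kernel

variable {Ω X : Type*} [MeasurableSpace Ω] [MeasurableSpace X] {P : Measure Ω} {κ : Kernel Ω X}

lemma measurable_kernel_real_section [IsMarkovKernel κ] {G : Set (Ω × X)} (hG : MeasurableSet G) :
    Measurable fun ω => (κ ω).real {x | (ω, x) ∈ G} :=
  (Kernel.measurable_kernel_prodMk_left hG).ennreal_toReal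

lemma measurable_kernel_real [IsMarkovKernel κ] {A : Set X} (hA : MeasurableSet A) :
    Measurable fun ω => (κ ω).real A :=
  (Kernel.measurable_coe κ hA).ennreal_toReal

lemma integral_kernel_real_section [IsProbabilityMeasure P] [IsMarkovKernel κ] {G : Set (Ω × X)}
    (hG : MeasurableSet G) :
    ∫ ω, (κ ω).real {x | (ω, x) ∈ G} ∂P = (P.compProd κ).real G := by
  rw [measureReal_def, Measure.compProd_apply hG]
  exact integral_toReal (Kernel.measurable_kernel_prodMk_left hG).aemeasurable
    (ae_of_all _ fun ω => measure_lt_top _ _)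

lemma integral_kernel_real [IsProbabilityMeasure P] [IsMarkovKernel κ] {A : Set X}
    (hA : MeasurableSet A) :
    ∫ ω, (κ ω).real A ∂P = (P.compProd κ).snd.real A := by
  rw [measureReal_def, Measure.snd_apply hA]
  exact integral_kernel_real_section (measurable_snd hA)

lemma integrable_of_abs_le [IsFiniteMeasure P] {u : Ω → ℝ} (hu : Measurable u) {B : ℝ}
    (h : ∀ ω, |u ω| ≤ B) : Integrable u P :=
  Integrable.of_bound hu.aestronglyMeasurable B (ae_of_all _ h)

end Kernel

/-! ### Comparison of the survival probability with the accumulated sample measure -/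

namespace RandomSystem.IsStationary

variable {Ω X : Type*} [MeasurableSpace Ω] [MeasurableSpace X] {R : RandomSystem Ω X}
  {P : Measure Ω} {κ : Kernel Ω X}

lemma measurable_real_noHit [IsMarkovKernel κ] (hR : R.IsStationary P κ) {A : Set X}
    (hA : MeasurableSet A) (m : ℕ) : Measurable fun ω => (κ ω).real (R.noHit A m ω) :=
  measurable_kernel_real_section (hR.measurableSet_noHit_prod hA m)

lemma measurable_real_inter_noHit [IsMarkovKernel κ] (hR : R.IsStationary P κ) {A : Set X}
    (hA : MeasurableSet A) (m : ℕ) : Measurable fun ω => (κ ω).real (A ∩ R.noHit A m ω) :=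
  measurable_kernel_real_section (G := {z | z.2 ∈ A} ∩ {z | z.2 ∈ R.noHit A m z.1})
    ((measurable_snd hA).inter (hR.measurableSet_noHit_prod hA m))

/-- Shifting the starting time by one removes the points that start in `A`. -/
lemma ae_real_noHit_succ [IsProbabilityMeasure P] [IsMarkovKernel κ] (hR : R.IsStationary P κ)
    {A : Set X} (hA : MeasurableSet A) (m : ℕ) :
    ∀ᵐ ω ∂P, (κ ω).real (R.noHit A (m + 1) ω)
      = (κ (R.θ ω)).real (R.noHit A m (R.θ ω)) - (κ (R.θ ω)).real (A ∩ R.noHit A m (R.θ ω)) := by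
  have hG : MeasurableSet ({z : Ω × X | z.2 ∉ A} ∩ {z : Ω × X | z.2 ∈ R.noHit A m z.1}) :=
    (measurable_snd hA.compl).inter (hR.measurableSet_noHit_prod hA m)
  filter_upwards [hR.ae_kernel_skew hG] with ω h
  have h1 : R.noHit A (m + 1) ω
      = {x | R.skew (ω, x) ∈ {z : Ω × X | z.2 ∉ A} ∩ {z : Ω × X | z.2 ∈ R.noHit A m z.1}} := by
    ext x
    exact mem_noHit_succ
  have h2 : (κ ω).real (R.noHit A (m + 1) ω)
      = (κ (R.θ ω)).real (R.noHit A m (R.θ ω) \ A) := by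
    rw [h1, measureReal_def, h, measureReal_def]
    congr 2
    ext x
    exact and_comm
  have h3 := measureReal_inter_add_sdiff (μ := κ (R.θ ω)) (s := R.noHit A m (R.θ ω)) hA
  rw [h2, Set.inter_comm A]
  linarith

lemma abs_sub_exp_neg_add_le {a V p S : ℝ} (ha : 0 ≤ a) (ha1 : a ≤ 1) (hV : 0 ≤ V) (hV1 : V ≤ 1) :
    |V - p - Real.exp (-(S + a))| ≤ |p - a * V| + a ^ 2 + |V - Real.exp (-S)| := by
  have h1 : |Real.exp (-a) - 1 - -a| ≤ (-a) ^ 2 :=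
    Real.abs_exp_sub_one_sub_id_le (by rw [abs_neg, abs_of_nonneg ha]; exact ha1)
  have h2 : V - p - Real.exp (-(S + a))
      = -(p - a * V) + -((Real.exp (-a) - 1 - -a) * V)
        + Real.exp (-a) * (V - Real.exp (-S)) := by
    rw [neg_add, Real.exp_add]
    ring
  have h3 : |(Real.exp (-a) - 1 - -a) * V| ≤ a ^ 2 := by
    rw [abs_mul, abs_of_nonneg hV]
    calc |Real.exp (-a) - 1 - -a| * V ≤ (-a) ^ 2 * 1 := by gcongr
      _ = a ^ 2 := by ring
  have h4 : |Real.exp (-a) * (V - Real.exp (-S))| ≤ |V - Real.exp (-S)| := by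
    rw [abs_mul, Real.abs_exp]
    exact mul_le_of_le_one_left (abs_nonneg _) (Real.exp_le_one_iff.2 (by linarith))
  rw [h2]
  refine (abs_add_le _ _).trans (add_le_add ((abs_add_le _ _).trans ?_) h4)
  rw [abs_neg, abs_neg]
  linarith

/-- If, on average over `ω`, being in `A` is nearly independent of avoiding `A` afterwards, then the
probability of avoiding `A` up to time `n` is close to the exponential of minus the sum of the
sample measures of `A` along the base orbit. -/
lemma integral_abs_real_noHit_sub_exp_le [IsProbabilityMeasure P] [IsMarkovKernel κ]
    (hR : R.IsStationary P κ) {A : Set X} (hA : MeasurableSet A) {q : ℝ}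
    (hq : ∀ m, ∫ ω, |(κ ω).real (A ∩ R.noHit A m ω)
      - (κ ω).real A * (κ ω).real (R.noHit A m ω)| ∂P ≤ q) (n : ℕ) :
    ∫ ω, |(κ ω).real (R.noHit A n ω)
      - Real.exp (-∑ i ∈ Finset.range n, (κ (R.θ^[i + 1] ω)).real A)| ∂P
      ≤ n * (q + ∫ ω, (κ ω).real A ^ 2 ∂P) := by
  have ma := measurable_kernel_real (κ := κ) hA
  have mV := hR.measurable_real_noHit hA
  have mp := hR.measurable_real_inter_noHit hA
  have mS : ∀ n, Measurable fun ω => ∑ i ∈ Finset.range n, (κ (R.θ^[i + 1] ω)).real A := fun n =>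
    Finset.measurable_sum _ fun i _ => ma.comp (measurable_iterate_base (i + 1))
  have mD : ∀ n, Measurable fun ω => |(κ ω).real (R.noHit A n ω)
      - Real.exp (-∑ i ∈ Finset.range n, (κ (R.θ^[i + 1] ω)).real A)| := fun n =>
    ((mV n).sub (Real.measurable_exp.comp (mS n).neg)).abs
  have mE : ∀ n, Measurable fun ω => |(κ ω).real (A ∩ R.noHit A n ω)
      - (κ ω).real A * (κ ω).real (R.noHit A n ω)| := fun n => ((mp n).sub (ma.mul (mV n))).abs
  have bD : ∀ n ω, |(κ ω).real (R.noHit A n ω)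
      - Real.exp (-∑ i ∈ Finset.range n, (κ (R.θ^[i + 1] ω)).real A)| ≤ 1 := fun n ω => by
    have h1 : (κ ω).real (R.noHit A n ω) ≤ 1 := measureReal_le_one
    have h2 : Real.exp (-∑ i ∈ Finset.range n, (κ (R.θ^[i + 1] ω)).real A) ≤ 1 :=
      Real.exp_le_one_iff.2 (neg_nonpos.2 (Finset.sum_nonneg fun _ _ => measureReal_nonneg))
    have h3 := Real.exp_pos (-∑ i ∈ Finset.range n, (κ (R.θ^[i + 1] ω)).real A)
    have h4 : 0 ≤ (κ ω).real (R.noHit A n ω) := measureReal_nonneg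
    rw [abs_le]
    constructor <;> linarith
  have bE : ∀ n ω, |(κ ω).real (A ∩ R.noHit A n ω)
      - (κ ω).real A * (κ ω).real (R.noHit A n ω)| ≤ 1 := fun n ω => by
    have h1 : (κ ω).real (A ∩ R.noHit A n ω) ≤ 1 := measureReal_le_one
    have h2 : 0 ≤ (κ ω).real (A ∩ R.noHit A n ω) := measureReal_nonneg
    have h3 : (κ ω).real A * (κ ω).real (R.noHit A n ω) ≤ 1 :=
      mul_le_one₀ measureReal_le_one measureReal_nonneg measureReal_le_one
    have h4 : 0 ≤ (κ ω).real A * (κ ω).real (R.noHit A n ω) := by positivity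
    rw [abs_le]
    constructor <;> linarith
  have ba : ∀ ω, |(κ ω).real A ^ 2| ≤ 1 := fun ω => by
    rw [abs_of_nonneg (by positivity)]
    exact pow_le_one₀ measureReal_nonneg measureReal_le_one
  induction n with
  | zero =>
    have h0 : ∀ ω, R.noHit A 0 ω = Set.univ := fun ω =>
      Set.eq_univ_of_forall fun x k hk hk0 => absurd hk (by omega)
    simp [h0]
  | succ n ih =>
    have hstep : ∀ᵐ ω ∂P, |(κ ω).real (R.noHit A (n + 1) ω)
        - Real.exp (-∑ i ∈ Finset.range (n + 1), (κ (R.θ^[i + 1] ω)).real A)|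
        ≤ (|(κ (R.θ ω)).real (A ∩ R.noHit A n (R.θ ω))
            - (κ (R.θ ω)).real A * (κ (R.θ ω)).real (R.noHit A n (R.θ ω))|
          + (κ (R.θ ω)).real A ^ 2)
          + |(κ (R.θ ω)).real (R.noHit A n (R.θ ω))
            - Real.exp (-∑ i ∈ Finset.range n, (κ (R.θ^[i + 1] (R.θ ω))).real A)| := by
      filter_upwards [hR.ae_real_noHit_succ hA n] with ω h
      rw [h, Finset.sum_range_succ']
      exact abs_sub_exp_neg_add_le measureReal_nonneg measureReal_le_one measureReal_nonneg
        measureReal_le_one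
    have hθ := R.θ.measurable
    have iE := integrable_of_abs_le (P := P) ((mE n).comp hθ) fun ω => by
      simpa using bE n (R.θ ω)
    have ia := integrable_of_abs_le (P := P) ((ma.pow_const 2).comp hθ) fun ω => ba (R.θ ω)
    have iD := integrable_of_abs_le (P := P) ((mD n).comp hθ) fun ω => by
      simpa using bD n (R.θ ω)
    have hle := integral_mono_ae
      (integrable_of_abs_le (P := P) (mD (n + 1)) fun ω => by simpa using bD (n + 1) ω)
      ((iE.add ia).add iD) hstep
    have hsplit := (integral_add (iE.add ia) iD).trans
      (congrArg (· + _) (integral_add iE ia))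
    have h1 := hR.integral_iterate 1 _ (mE n)
    have h2 := hR.integral_iterate 1 _ (ma.pow_const 2)
    have h3 := hR.integral_iterate 1 _ (mD n)
    have hq' := hq n
    simp only [Function.iterate_one] at h1 h2 h3
    simp only [Function.comp_def, Pi.add_apply] at hsplit hle
    rw [hsplit, h1, h2, h3] at hle
    push_cast
    linarith

end RandomSystem.IsStationary

section Bump

lemma exists_lipschitz_bump {X : Type*} [MetricSpace X] (y : X) (r : ℝ) {ρ : ℝ} (hρ : 0 < ρ) :
    ∃ φ : X → ℝ, LipschitzWith (Real.toNNReal ρ⁻¹) φ ∧ (∀ x, 0 ≤ φ x) ∧ (∀ x, φ x ≤ 1) ∧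
      (∀ x ∈ Metric.ball y r, φ x = 1) ∧ ∀ x ∉ Metric.ball y (r + ρ), φ x = 0 := by
  refine ⟨fun x => max 0 (min 1 (ρ⁻¹ * (r + ρ - dist x y))), ?_, fun x => le_max_left _ _,
    fun x => max_le zero_le_one (min_le_left _ _), fun x hx => ?_, fun x hx => ?_⟩
  · have h : LipschitzWith (Real.toNNReal ρ⁻¹) fun x => ρ⁻¹ * (r + ρ - dist x y) := by
      refine LipschitzWith.of_dist_le_mul fun u v => ?_
      rw [Real.coe_toNNReal _ (inv_nonneg.2 hρ.le), Real.dist_eq, ← mul_sub, abs_mul,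
        abs_of_nonneg (inv_nonneg.2 hρ.le)]
      gcongr
      have h1 := abs_dist_sub_le v u y
      rwa [dist_comm v u, show dist v y - dist u y = r + ρ - dist u y - (r + ρ - dist v y) by ring]
        at h1
    exact (h.const_min 1).const_max 0
  · have h : 1 ≤ ρ⁻¹ * (r + ρ - dist x y) := by
      rw [inv_mul_eq_div, one_le_div hρ]
      have := Metric.mem_ball.1 hx
      linarith
    simp [min_eq_left h]
  · have h : ρ⁻¹ * (r + ρ - dist x y) ≤ 0 := by
      refine mul_nonpos_of_nonneg_of_nonpos (inv_nonneg.2 hρ.le) ?_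
      have := not_lt.1 (mt Metric.mem_ball.2 hx)
      linarith
    exact max_eq_left ((min_le_right _ _).trans h)

/-- Sandwich of the integral of a function that is `1` on `A` and `0` off `A'`. -/
lemma integral_bump_mem_Icc {X : Type*} [MeasurableSpace X] {m : Measure X} [IsProbabilityMeasure m]
    {A A' G : Set X}
    (hA : MeasurableSet A) (hA' : MeasurableSet A') (hG : MeasurableSet G) (hAA' : A ⊆ A')
    {φ : X → ℝ} (hφm : Measurable φ) (h0 : ∀ x, 0 ≤ φ x) (h1 : ∀ x, φ x ≤ 1)
    (hφA : ∀ x ∈ A, φ x = 1) (hφA' : ∀ x ∉ A', φ x = 0) :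
    m.real (A ∩ G) ≤ ∫ x, φ x * G.indicator 1 x ∂m ∧
      ∫ x, φ x * G.indicator 1 x ∂m ≤ m.real (A ∩ G) + (m.real A' - m.real A) := by
  have hint : Integrable (fun x => φ x * G.indicator 1 x) m := by
    refine Integrable.of_bound
      (hφm.mul (measurable_one.indicator hG)).aestronglyMeasurable 1 (ae_of_all _ fun x => ?_)
    by_cases hx : x ∈ G <;> simp [hx, abs_of_nonneg (h0 x), h1 x]
  have i1 : Integrable ((A ∩ G).indicator (1 : X → ℝ)) m :=
    (integrable_const 1).indicator (hA.inter hG)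
  have i2 : Integrable ((A' \ A).indicator (1 : X → ℝ)) m :=
    (integrable_const 1).indicator (hA'.diff hA)
  constructor
  · rw [← integral_indicator_one (hA.inter hG)]
    refine integral_mono i1 hint fun x => ?_
    by_cases hxA : x ∈ A <;> by_cases hxG : x ∈ G <;> simp [hxA, hxG, hφA, h0]
  · rw [← measureReal_sdiff hAA' hA, ← integral_indicator_one (hA.inter hG),
      ← integral_indicator_one (hA'.diff hA), ← integral_add i1 i2]
    refine integral_mono hint (i1.add i2) fun x => ?_
    by_cases hxA : x ∈ A
    · by_cases hxG : x ∈ G <;> simp [hxA, hxG, hφA]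
    · by_cases hxA' : x ∈ A' <;> by_cases hxG : x ∈ G <;> simp [hxA, hxA', hxG, hφA', h1]

end Bump

section Mixing

variable {Ω X : Type*} [MeasurableSpace Ω] [MetricSpace X] [MeasurableSpace X] [BorelSpace X]
  {R : RandomSystem Ω X} {P : Measure Ω} {κ : Kernel Ω X} {C : Ω → ℝ} {γ : ℕ → ℝ}

/-- Fibered decay of correlations between a ball and an arbitrary measurable set; replacing the ball
by a Lipschitz function costs the measure of an annulus of width `ρ`. -/
lemma FiberedDecay.ae_abs_real_inter_sub_le [IsMarkovKernel κ] (h3 : FiberedDecay R P κ C γ)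
    (hR : R.IsStationary P κ) :
    ∀ᵐ ω ∂P, ∀ (ℓ : ℕ) (y : X) (r ρ : ℝ) (B : Set X), 1 ≤ ℓ → 0 < ρ → MeasurableSet B →
      |(κ ω).real (Metric.ball y r ∩ {x | R.iter ℓ ω x ∈ B})
          - (κ ω).real (Metric.ball y r) * (κ (R.θ^[ℓ] ω)).real B|
        ≤ ((κ ω).real (Metric.ball y (r + ρ)) - (κ ω).real (Metric.ball y r))
          + |C ω| * (|γ ℓ| * ρ⁻¹) := by
  filter_upwards [h3] with ω h ℓ y r ρ B hℓ hρ hB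
  obtain ⟨φ, hφL, hφ0, hφ1, hφA, hφA'⟩ := exists_lipschitz_bump y r hρ
  have hψm : Measurable (B.indicator (1 : X → ℝ)) := measurable_one.indicator hB
  have hψ1 : ∀ x, |B.indicator (1 : X → ℝ) x| ≤ 1 := fun x => by
    by_cases hx : x ∈ B <;> simp [hx]
  have hmain := h ℓ φ (B.indicator 1) _ 1 hℓ hφL hψm hψ1
  rw [Real.coe_toNNReal _ (inv_nonneg.2 hρ.le), mul_one, integral_indicator_one hB] at hmain
  have hG : MeasurableSet {x | R.iter ℓ ω x ∈ B} := hR.measurable_iter_right ℓ ω hB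
  have hsub : Metric.ball y r ⊆ Metric.ball y (r + ρ) :=
    Metric.ball_subset_ball (by linarith)
  have hb1 := integral_bump_mem_Icc (m := κ ω) measurableSet_ball measurableSet_ball hG hsub
    hφL.continuous.measurable hφ0 hφ1 hφA hφA'
  have hb2 := integral_bump_mem_Icc (m := κ ω) measurableSet_ball measurableSet_ball
    MeasurableSet.univ hsub hφL.continuous.measurable hφ0 hφ1 hφA hφA'
  simp only [Set.inter_univ, Set.indicator_univ, Pi.one_apply, mul_one] at hb2
  have hind : ∀ x, B.indicator (1 : X → ℝ) (R.iter ℓ ω x)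
      = {x | R.iter ℓ ω x ∈ B}.indicator 1 x := fun x => rfl
  simp only [hind] at hmain
  have hV0 : 0 ≤ (κ (R.θ^[ℓ] ω)).real B := measureReal_nonneg
  have hV1 : (κ (R.θ^[ℓ] ω)).real B ≤ 1 := measureReal_le_one
  set V := (κ (R.θ^[ℓ] ω)).real B
  set a := (κ ω).real (Metric.ball y r)
  set a' := (κ ω).real (Metric.ball y (r + ρ))
  set F := ∫ x, φ x ∂(κ ω)
  have haa' : 0 ≤ a' - a := sub_nonneg.2 (measureReal_mono hsub)
  have hFV1 : a * V ≤ F * V := mul_le_mul_of_nonneg_right hb2.1 hV0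
  have hFV2 : F * V ≤ a * V + (a' - a) := by nlinarith
  have herr : C ω * γ ℓ * ρ⁻¹ ≤ |C ω| * (|γ ℓ| * ρ⁻¹) := by
    rw [← mul_assoc, ← abs_mul]
    exact mul_le_mul_of_nonneg_right (le_abs_self _) (inv_nonneg.2 hρ.le)
  obtain ⟨hm1, hm2⟩ := abs_le.1 hmain
  rw [abs_le]
  constructor <;> linarith [hb1.1, hb1.2]

/-- A quantity in `(-∞, 1]` bounded by a nonnegative part plus an error of the form `c * w`: the
error may be replaced by `c ^ p * w ^ p`, which only needs `c ∈ L^p`. -/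
lemma le_add_rpow_mul_rpow {e x c w p : ℝ} (he : e ≤ 1) (hx : 0 ≤ x) (hc : 0 ≤ c) (hw : 0 ≤ w)
    (hp : 0 < p) (hp1 : p ≤ 1) (h : e ≤ x + c * w) : e ≤ x + c ^ p * w ^ p := by
  rw [← Real.mul_rpow hc hw]
  have hcw : 0 ≤ c * w := by positivity
  rcases le_total (c * w) 1 with h1 | h1
  · exact h.trans (by linarith [Real.self_le_rpow_of_le_one hcw h1 hp1])
  · exact he.trans (by linarith [Real.one_le_rpow h1 hp.le])

/-- On average, being in a ball is nearly independent of avoiding the ball afterwards, up to the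
probability of a return within a gap `g`, the measure of an annulus, and the decay at time `g`. -/
lemma FiberedDecay.integral_abs_inter_noHit_sub_le [IsProbabilityMeasure P] [IsMarkovKernel κ]
    (h3 : FiberedDecay R P κ C γ) (hR : R.IsStationary P κ) {p : ℝ} (hp : 0 < p) (hp1 : p ≤ 1)
    (hC : Integrable (fun ω => |C ω| ^ p) P) {y : X} {r ρ h : ℝ} (hρ : 0 < ρ)
    (hh : ∀ᵐ ω ∂P, (κ ω).real (Metric.ball y r) ≤ h) {g : ℕ} (hg : 1 ≤ g) (m : ℕ) :
    ∫ ω, |(κ ω).real (Metric.ball y r ∩ R.noHit (Metric.ball y r) m ω)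
      - (κ ω).real (Metric.ball y r) * (κ ω).real (R.noHit (Metric.ball y r) m ω)| ∂P
    ≤ (P.compProd κ).real {z | z.2 ∈ Metric.ball y r ∧ z.2 ∉ R.noHit (Metric.ball y r) g z.1}
      + (P.compProd κ).snd.real (Metric.ball y r) * (g * h)
      + ((P.compProd κ).snd.real (Metric.ball y (r + ρ))
        - (P.compProd κ).snd.real (Metric.ball y r))
      + (∫ ω, |C ω| ^ p ∂P) * (|γ g| * ρ⁻¹) ^ p := by
  set A := Metric.ball y r with hAdef
  set A' := Metric.ball y (r + ρ) with hA'def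
  have hA : MeasurableSet A := measurableSet_ball
  have hA' : MeasurableSet A' := measurableSet_ball
  have hsub : A ⊆ A' := Metric.ball_subset_ball (by linarith)
  have hGs : MeasurableSet {z : Ω × X | z.2 ∈ A ∧ z.2 ∉ R.noHit A g z.1} :=
    (measurable_snd hA).inter (hR.measurableSet_noHit_prod hA g).compl
  have ms : Measurable fun ω => (κ ω).real {x | x ∈ A ∧ x ∉ R.noHit A g ω} :=
    measurable_kernel_real_section hGs
  have ma := measurable_kernel_real (κ := κ) hA
  have ma' := measurable_kernel_real (κ := κ) hA'
  have bound1 : ∀ (ω : Ω) (s : Set X), |(κ ω).real s| ≤ 1 := fun ω s => by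
    rw [abs_of_nonneg measureReal_nonneg]
    exact measureReal_le_one
  -- the probability of a visit to `A` during the gap
  have hvisit : ∀ᵐ ω ∂P, (κ ω).real (R.noHit A g ω)ᶜ ≤ g * h := by
    have hshift : ∀ᵐ ω ∂P, ∀ k : ℕ, (κ ω).real {x | R.iter k ω x ∈ A} ≤ h := by
      refine ae_all_iff.2 fun k => ?_
      filter_upwards [hR.ae_kernel_real_iter k hA,
        (hR.base_iterate k).quasiMeasurePreserving.ae hh] with ω h1 h2
      rw [h1]
      exact h2
    filter_upwards [hshift] with ω hω
    have hcov : (R.noHit A g ω)ᶜ ⊆ ⋃ k ∈ Finset.Icc 1 g, {x | R.iter k ω x ∈ A} := by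
      intro x hx
      simp only [RandomSystem.noHit, Set.mem_compl_iff, Set.mem_ofPred_eq, not_forall, not_not] at hx
      obtain ⟨k, hk1, hkg, hk⟩ := hx
      exact Set.mem_iUnion₂.2 ⟨k, Finset.mem_Icc.2 ⟨hk1, hkg⟩, hk⟩
    calc (κ ω).real (R.noHit A g ω)ᶜ
        ≤ ∑ k ∈ Finset.Icc 1 g, (κ ω).real {x | R.iter k ω x ∈ A} :=
          (measureReal_mono hcov (measure_ne_top _ _)).trans (measureReal_biUnion_finset_le _ _)
      _ ≤ ∑ _k ∈ Finset.Icc 1 g, h := Finset.sum_le_sum fun k _ => hω k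
      _ = g * h := by simp
  have hpt : ∀ᵐ ω ∂P, |(κ ω).real (A ∩ R.noHit A m ω)
      - (κ ω).real A * (κ ω).real (R.noHit A m ω)|
      ≤ ((κ ω).real {x | x ∈ A ∧ x ∉ R.noHit A g ω} + (κ ω).real A * (g * h)
        + ((κ ω).real A' - (κ ω).real A)) + |C ω| ^ p * (|γ g| * ρ⁻¹) ^ p := by
    filter_upwards [h3.ae_abs_real_inter_sub_le hR, hvisit,
      hR.ae_kernel_real_iter_noHit g (m - g) hA] with ω hmix hv hiter
    have hmix' := hmix g y r ρ (R.noHit A (m - g) (R.θ^[g] ω)) hg hρ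
      (hR.measurableSet_noHit hA _ _)
    rw [← hiter] at hmix'
    set G := {x | R.iter g ω x ∈ R.noHit A (m - g) (R.θ^[g] ω)} with hGdef
    -- replacing "no visit up to `m`" by "no visit between `g` and `m`"
    have hHG : R.noHit A m ω ⊆ G := fun x hx => RandomSystem.iter_mem_noHit_of_mem hx
    have hGH : G ⊆ R.noHit A m ω ∪ (R.noHit A g ω)ᶜ := fun x hx => by
      by_cases hxg : x ∈ R.noHit A g ω
      · exact Or.inl (RandomSystem.mem_noHit_of_iter_mem hxg hx)
      · exact Or.inr hxg
    have u1 : (κ ω).real (A ∩ R.noHit A m ω) ≤ (κ ω).real (A ∩ G) :=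
      measureReal_mono (Set.inter_subset_inter_right _ hHG)
    have u2 : (κ ω).real (A ∩ G) ≤ (κ ω).real (A ∩ R.noHit A m ω)
        + (κ ω).real {x | x ∈ A ∧ x ∉ R.noHit A g ω} := by
      refine (measureReal_mono fun x hx => ?_).trans (measureReal_union_le _ _)
      rcases hGH hx.2 with h' | h'
      · exact Or.inl ⟨hx.1, h'⟩
      · exact Or.inr ⟨hx.1, h'⟩
    have u3 : (κ ω).real (R.noHit A m ω) ≤ (κ ω).real G := measureReal_mono hHG
    have u4 : (κ ω).real G ≤ (κ ω).real (R.noHit A m ω) + g * h :=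
      ((measureReal_mono hGH).trans (measureReal_union_le _ _)).trans (by linarith)
    have ha0 : 0 ≤ (κ ω).real A := measureReal_nonneg
    have u5 := mul_le_mul_of_nonneg_left u3 ha0
    have u6 := mul_le_mul_of_nonneg_left u4 ha0
    rw [mul_add] at u6
    have hs0 : 0 ≤ (κ ω).real {x | x ∈ A ∧ x ∉ R.noHit A g ω} := measureReal_nonneg
    have hgh : 0 ≤ (g : ℝ) * h := measureReal_nonneg.trans hv
    have hann : 0 ≤ (κ ω).real A' - (κ ω).real A := sub_nonneg.2 (measureReal_mono hsub)
    have hagh : 0 ≤ (κ ω).real A * (g * h) := mul_nonneg ha0 hgh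
    refine le_add_rpow_mul_rpow ?_ (by linarith) (abs_nonneg _)
      (mul_nonneg (abs_nonneg _) (inv_nonneg.2 hρ.le)) hp hp1 ?_
    · have v1 := bound1 ω (A ∩ R.noHit A m ω)
      have v2 : (κ ω).real A * (κ ω).real (R.noHit A m ω) ≤ 1 :=
        mul_le_one₀ measureReal_le_one measureReal_nonneg measureReal_le_one
      have v3 : 0 ≤ (κ ω).real A * (κ ω).real (R.noHit A m ω) :=
        mul_nonneg ha0 measureReal_nonneg
      have v4 : 0 ≤ (κ ω).real (A ∩ R.noHit A m ω) := measureReal_nonneg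
      rw [abs_le] at v1 ⊢
      constructor <;> linarith
    · obtain ⟨w1, w2⟩ := abs_le.1 hmix'
      rw [abs_le]
      constructor <;> linarith
  have is : Integrable (fun ω => (κ ω).real {x | x ∈ A ∧ x ∉ R.noHit A g ω}) P :=
    integrable_of_abs_le ms fun ω => bound1 ω _
  have ia : Integrable (fun ω => (κ ω).real A) P := integrable_of_abs_le ma fun ω => bound1 ω _
  have ia' : Integrable (fun ω => (κ ω).real A') P := integrable_of_abs_le ma' fun ω => bound1 ω _
  have hE : Integrable (fun ω => |(κ ω).real (A ∩ R.noHit A m ω)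
      - (κ ω).real A * (κ ω).real (R.noHit A m ω)|) P :=
    ((integrable_of_abs_le (hR.measurable_real_inter_noHit hA m) fun ω => bound1 ω _).sub
      (integrable_of_abs_le (B := 1) (ma.mul (hR.measurable_real_noHit hA m)) fun ω => by
        rw [Pi.mul_apply, abs_mul]
        exact mul_le_one₀ (bound1 ω _) (abs_nonneg _) (bound1 ω _))).abs
  have i2 : Integrable (fun ω => (κ ω).real A * (g * h)) P := ia.mul_const _
  have i12 : Integrable (fun ω => (κ ω).real {x | x ∈ A ∧ x ∉ R.noHit A g ω}
      + (κ ω).real A * (g * h)) P := is.add i2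
  have i3 : Integrable (fun ω => (κ ω).real A' - (κ ω).real A) P := ia'.sub ia
  have i123 : Integrable (fun ω => (κ ω).real {x | x ∈ A ∧ x ∉ R.noHit A g ω}
      + (κ ω).real A * (g * h) + ((κ ω).real A' - (κ ω).real A)) P := i12.add i3
  have i4 : Integrable (fun ω => |C ω| ^ p * (|γ g| * ρ⁻¹) ^ p) P := hC.mul_const _
  refine (integral_mono_ae hE (i123.add i4) hpt).trans (le_of_eq ?_)
  rw [integral_add' i123 i4, integral_add i12 i3, integral_add is i2, integral_sub ia' ia,
    integral_mul_const, integral_mul_const, integral_kernel_real hA, integral_kernel_real hA',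
    ← integral_kernel_real_section hGs]
  rfl

end Mixing

/-! ### Concentration of the accumulated sample measure -/

section Variance

variable {Ω : Type*} [MeasurableSpace Ω] {P : Measure Ω} [IsProbabilityMeasure P]

lemma card_filter_dist_lt_le (n g i : ℕ) :
    ((Finset.range n).filter fun j => (j - i) + (i - j) < g).card ≤ 2 * g := by
  have hsub : ((Finset.range n).filter fun j => (j - i) + (i - j) < g)
      ⊆ Finset.Ico (i + 1 - g) (i + g) := fun j hj => by
    have := (Finset.mem_filter.1 hj).2
    rw [Finset.mem_Ico]
    omega
  refine (Finset.card_le_card hsub).trans ?_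
  rw [Nat.card_Ico]
  omega

/-- Second moment of a stationary sum whose autocovariances are at most `s`, and at most `w` beyond
the lag `g`. -/
lemma integral_sq_sum_iterate_le {T : Ω → Ω} (hT : MeasurePreserving T P P) {u : Ω → ℝ}
    (hu : Measurable u) {B : ℝ} (hB : ∀ ω, |u ω| ≤ B) {s w : ℝ} (hs : 0 ≤ s) (hw : 0 ≤ w) {g : ℕ}
    (h1 : ∀ ℓ, ∫ ω, u ω * u (T^[ℓ] ω) ∂P ≤ s)
    (h2 : ∀ ℓ, g ≤ ℓ → ∫ ω, u ω * u (T^[ℓ] ω) ∂P ≤ w) (n : ℕ) :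
    ∫ ω, (∑ i ∈ Finset.range n, u (T^[i + 1] ω)) ^ 2 ∂P ≤ n * (2 * g * s) + n ^ 2 * w := by
  have mu : ∀ k, Measurable fun ω => u (T^[k] ω) := fun k => hu.comp (hT.iterate k).measurable
  have hint : ∀ i j, Integrable (fun ω => u (T^[i] ω) * u (T^[j] ω)) P := fun i j =>
    integrable_of_abs_le (B := B * B) ((mu i).mul (mu j)) fun ω => by
      rw [abs_mul]
      exact mul_le_mul (hB _) (hB _) (abs_nonneg _) ((abs_nonneg _).trans (hB ω))
  have hshift : ∀ i k, ∫ ω, u (T^[i] ω) * u (T^[i + k] ω) ∂P = ∫ ω, u ω * u (T^[k] ω) ∂P := by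
    intro i k
    have h := hT.iterate i
    conv_rhs => rw [← h.map_eq]
    have hm : Measurable fun ω => u ω * u (T^[k] ω) := hu.mul (mu k)
    rw [integral_map h.measurable.aemeasurable hm.aestronglyMeasurable]
    refine integral_congr_ae (ae_of_all _ fun ω => ?_)
    simp only
    rw [add_comm i k, Function.iterate_add_apply]
  have hcov : ∀ i j, ∫ ω, u (T^[i + 1] ω) * u (T^[j + 1] ω) ∂P
      ≤ (if (j - i) + (i - j) < g then s else 0) + w := by
    intro i j
    have heq : ∫ ω, u (T^[i + 1] ω) * u (T^[j + 1] ω) ∂P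
        = ∫ ω, u ω * u (T^[(j - i) + (i - j)] ω) ∂P := by
      rcases le_total i j with hij | hij
      · rw [← hshift (i + 1)]
        congr! 5
        omega
      · rw [← hshift (j + 1)]
        simp_rw [mul_comm (u (T^[i + 1] _))]
        congr! 5
        omega
    rw [heq]
    split_ifs with hlt
    · linarith [h1 ((j - i) + (i - j))]
    · linarith [h2 ((j - i) + (i - j)) (not_lt.1 hlt)]
  calc ∫ ω, (∑ i ∈ Finset.range n, u (T^[i + 1] ω)) ^ 2 ∂P
      = ∫ ω, ∑ i ∈ Finset.range n, ∑ j ∈ Finset.range n,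
          u (T^[i + 1] ω) * u (T^[j + 1] ω) ∂P := by simp_rw [sq, Finset.sum_mul_sum]
    _ = ∑ i ∈ Finset.range n, ∑ j ∈ Finset.range n,
          ∫ ω, u (T^[i + 1] ω) * u (T^[j + 1] ω) ∂P := by
        rw [integral_finsetSum _ fun i _ => integrable_finsetSum _ fun j _ => hint _ _]
        exact Finset.sum_congr rfl fun i _ => integral_finsetSum _ fun j _ => hint _ _
    _ ≤ ∑ i ∈ Finset.range n, ∑ j ∈ Finset.range n,
          ((if (j - i) + (i - j) < g then s else 0) + w) :=
        Finset.sum_le_sum fun i _ => Finset.sum_le_sum fun j _ => hcov i j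
    _ ≤ ∑ _i ∈ Finset.range n, (2 * g * s + n * w) := by
        refine Finset.sum_le_sum fun i _ => ?_
        rw [Finset.sum_add_distrib, ← Finset.sum_filter, Finset.sum_const, Finset.sum_const,
          Finset.card_range, nsmul_eq_mul, nsmul_eq_mul]
        gcongr
        exact_mod_cast card_filter_dist_lt_le n g i
    _ = n * (2 * g * s) + n ^ 2 * w := by
        rw [Finset.sum_const, Finset.card_range, nsmul_eq_mul]
        ring

end Variance

section Correlation

variable {Ω X : Type*} [MeasurableSpace Ω] [MetricSpace X] [MeasurableSpace X] [BorelSpace X]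
  {R : RandomSystem Ω X} {P : Measure Ω} [IsProbabilityMeasure P] {κ : Kernel Ω X}
  [IsMarkovKernel κ] {C : Ω → ℝ} {C₀ : ℝ} {γ : ℕ → ℝ}

/-- Annealed decay of correlations for a ball and a measurable set. -/
lemma AnnealedDecay.real_inter_le (h1 : AnnealedDecay R P κ (P.compProd κ).snd C₀ γ)
    (hR : R.IsStationary P κ) {ℓ : ℕ} (hℓ : 1 ≤ ℓ) (y : X) (r : ℝ) {ρ : ℝ} (hρ : 0 < ρ) {B : Set X}
    (hB : MeasurableSet B) :
    (P.compProd κ).real {z | z.2 ∈ Metric.ball y r ∧ R.iter ℓ z.1 z.2 ∈ B}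
      ≤ (P.compProd κ).snd.real (Metric.ball y (r + ρ)) * (P.compProd κ).snd.real B
        + |C₀| * (|γ ℓ| * ρ⁻¹) := by
  obtain ⟨φ, hφL, hφ0, hφ1, hφA, hφA'⟩ := exists_lipschitz_bump y r hρ
  have hφm : Measurable φ := hφL.continuous.measurable
  have hψm : Measurable (B.indicator (1 : X → ℝ)) := measurable_one.indicator hB
  have hψ1 : ∀ x, |B.indicator (1 : X → ℝ) x| ≤ 1 := fun x => by
    by_cases hx : x ∈ B <;> simp [hx]
  have hmain := h1 ℓ φ (B.indicator 1) _ 1 hℓ hφL hψm hψ1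
  rw [Real.coe_toNNReal _ (inv_nonneg.2 hρ.le), mul_one, integral_indicator_one hB] at hmain
  have hsub : Metric.ball y r ⊆ Metric.ball y (r + ρ) :=
    Metric.ball_subset_ball (by linarith)
  have hb := integral_bump_mem_Icc (m := (P.compProd κ).snd) measurableSet_ball measurableSet_ball
    MeasurableSet.univ hsub hφm hφ0 hφ1 hφA hφA'
  simp only [Set.inter_univ, Set.indicator_univ, Pi.one_apply, mul_one] at hb
  have hmeas : Measurable fun z : Ω × X => φ z.2 * B.indicator 1 (R.iter ℓ z.1 z.2) :=
    (hφm.comp measurable_snd).mul (hψm.comp (hR.measurable_iter ℓ))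
  have hbd : ∀ (ω : Ω) (x : X), ‖φ x * B.indicator 1 (R.iter ℓ ω x)‖ ≤ 1 := fun ω x => by
    rw [norm_mul]
    exact mul_le_one₀ (by rw [Real.norm_of_nonneg (hφ0 x)]; exact hφ1 x) (norm_nonneg _) (hψ1 _)
  have hI : Integrable (fun ω => ∫ x, φ x * B.indicator 1 (R.iter ℓ ω x) ∂(κ ω)) P := by
    refine Integrable.of_bound
      (hmeas.stronglyMeasurable.integral_kernel_prod_right' (κ := κ)).aestronglyMeasurable 1
      (ae_of_all _ fun ω => ?_)
    refine (norm_integral_le_of_norm_le_const (ae_of_all _ (hbd ω))).trans ?_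
    simp
  have hGm : MeasurableSet {z : Ω × X | z.2 ∈ Metric.ball y r ∧ R.iter ℓ z.1 z.2 ∈ B} :=
    (measurable_snd measurableSet_ball).inter (hR.measurable_iter ℓ hB)
  have hle : (P.compProd κ).real {z | z.2 ∈ Metric.ball y r ∧ R.iter ℓ z.1 z.2 ∈ B}
      ≤ ∫ ω, ∫ x, φ x * B.indicator 1 (R.iter ℓ ω x) ∂(κ ω) ∂P := by
    rw [← integral_kernel_real_section hGm]
    refine integral_mono (integrable_of_abs_le (B := 1)
      (measurable_kernel_real_section hGm) fun ω => ?_) hI fun ω => ?_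
    · rw [abs_of_nonneg measureReal_nonneg]
      exact measureReal_le_one
    · exact (integral_bump_mem_Icc (m := κ ω) measurableSet_ball measurableSet_ball
        (hR.measurable_iter_right ℓ ω hB) hsub hφm hφ0 hφ1 hφA hφA').1
  have hF : (∫ x, φ x ∂(P.compProd κ).snd) * (P.compProd κ).snd.real B
      ≤ (P.compProd κ).snd.real (Metric.ball y (r + ρ)) * (P.compProd κ).snd.real B :=
    mul_le_mul_of_nonneg_right (by linarith [hb.2]) measureReal_nonneg
  have herr : C₀ * γ ℓ * ρ⁻¹ ≤ |C₀| * (|γ ℓ| * ρ⁻¹) := by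
    rw [← mul_assoc, ← abs_mul]
    exact mul_le_mul_of_nonneg_right (le_abs_self _) (inv_nonneg.2 hρ.le)
  linarith [(abs_le.1 hmain).2]

/-- The sample measures of a ball at times `0` and `ℓ` are nearly uncorrelated. -/
lemma FiberedDecay.integral_real_mul_real_le (h3 : FiberedDecay R P κ C γ)
    (h1 : AnnealedDecay R P κ (P.compProd κ).snd C₀ γ) (hR : R.IsStationary P κ) {p : ℝ}
    (hp : 0 < p) (hp1 : p ≤ 1) (hC : Integrable (fun ω => |C ω| ^ p) P) (y : X) (r : ℝ) {ρ : ℝ}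
    (hρ : 0 < ρ) {ℓ : ℕ} (hℓ : 1 ≤ ℓ) :
    ∫ ω, (κ ω).real (Metric.ball y r) * (κ (R.θ^[ℓ] ω)).real (Metric.ball y r) ∂P
      ≤ (P.compProd κ).snd.real (Metric.ball y r) ^ 2
        + 2 * ((P.compProd κ).snd.real (Metric.ball y (r + ρ))
          - (P.compProd κ).snd.real (Metric.ball y r))
        + |C₀| * (|γ ℓ| * ρ⁻¹) + (∫ ω, |C ω| ^ p ∂P) * (|γ ℓ| * ρ⁻¹) ^ p := by
  have hann := h1.real_inter_le hR hℓ y r hρ (measurableSet_ball (x := y) (ε := r))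
  set A := Metric.ball y r with hAdef
  set A' := Metric.ball y (r + ρ) with hA'def
  have hA : MeasurableSet A := measurableSet_ball
  have hA' : MeasurableSet A' := measurableSet_ball
  have hsub : A ⊆ A' := Metric.ball_subset_ball (by linarith)
  have hGm : MeasurableSet {z : Ω × X | z.2 ∈ A ∧ R.iter ℓ z.1 z.2 ∈ A} :=
    (measurable_snd hA).inter (hR.measurable_iter ℓ hA)
  have ma := measurable_kernel_real (κ := κ) hA
  have ma' := measurable_kernel_real (κ := κ) hA'
  have bound1 : ∀ (ω : Ω) (s : Set X), |(κ ω).real s| ≤ 1 := fun ω s => by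
    rw [abs_of_nonneg measureReal_nonneg]
    exact measureReal_le_one
  have hpt : ∀ᵐ ω ∂P, (κ ω).real A * (κ (R.θ^[ℓ] ω)).real A
      ≤ ((κ ω).real {x | x ∈ A ∧ R.iter ℓ ω x ∈ A} + ((κ ω).real A' - (κ ω).real A))
        + |C ω| ^ p * (|γ ℓ| * ρ⁻¹) ^ p := by
    filter_upwards [h3.ae_abs_real_inter_sub_le hR] with ω hmix
    have hmix' := hmix ℓ y r ρ A hℓ hρ hA
    have hann : 0 ≤ (κ ω).real A' - (κ ω).real A := sub_nonneg.2 (measureReal_mono hsub)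
    have hs0 : 0 ≤ (κ ω).real {x | x ∈ A ∧ R.iter ℓ ω x ∈ A} := measureReal_nonneg
    have hset : A ∩ {x | R.iter ℓ ω x ∈ A} = {x | x ∈ A ∧ R.iter ℓ ω x ∈ A} := rfl
    rw [← hAdef, hset] at hmix'
    refine le_add_rpow_mul_rpow
      (mul_le_one₀ measureReal_le_one measureReal_nonneg measureReal_le_one) (by linarith)
      (abs_nonneg _) (mul_nonneg (abs_nonneg _) (inv_nonneg.2 hρ.le)) hp hp1 ?_
    linarith [(abs_le.1 hmix').1]
  have is : Integrable (fun ω => (κ ω).real {x | x ∈ A ∧ R.iter ℓ ω x ∈ A}) P :=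
    integrable_of_abs_le (measurable_kernel_real_section hGm) fun ω => bound1 ω _
  have ia : Integrable (fun ω => (κ ω).real A) P := integrable_of_abs_le ma fun ω => bound1 ω _
  have ia' : Integrable (fun ω => (κ ω).real A') P := integrable_of_abs_le ma' fun ω => bound1 ω _
  have i2 : Integrable (fun ω => (κ ω).real A' - (κ ω).real A) P := ia'.sub ia
  have i12 : Integrable (fun ω => (κ ω).real {x | x ∈ A ∧ R.iter ℓ ω x ∈ A}
      + ((κ ω).real A' - (κ ω).real A)) P := is.add i2
  have i3 : Integrable (fun ω => |C ω| ^ p * (|γ ℓ| * ρ⁻¹) ^ p) P := hC.mul_const _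
  have hE : Integrable (fun ω => (κ ω).real A * (κ (R.θ^[ℓ] ω)).real A) P :=
    integrable_of_abs_le (B := 1) (ma.mul (ma.comp (RandomSystem.measurable_iterate_base ℓ)))
      fun ω => by
        rw [abs_mul]
        exact mul_le_one₀ (bound1 ω _) (abs_nonneg _) (bound1 _ _)
  refine (integral_mono_ae hE (i12.add i3) hpt).trans ?_
  rw [integral_add' i12 i3, integral_add is i2, integral_sub ia' ia, integral_mul_const,
    integral_kernel_real hA, integral_kernel_real hA',
    show ∫ ω, (κ ω).real {x | x ∈ A ∧ R.iter ℓ ω x ∈ A} ∂P = _ from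
      integral_kernel_real_section hGm]
  have hε0 : 0 ≤ (P.compProd κ).snd.real A := measureReal_nonneg
  have hε1 : (P.compProd κ).snd.real A ≤ 1 := measureReal_le_one
  have hεε : 0 ≤ (P.compProd κ).snd.real A' - (P.compProd κ).snd.real A :=
    sub_nonneg.2 (measureReal_mono hsub)
  nlinarith

end Correlation

/-! ### The quantitative exponential law for one ball -/

section Quantitative

lemma abs_exp_neg_sub_exp_neg_le {x y : ℝ} (hx : 0 ≤ x) (hy : 0 ≤ y) :
    |Real.exp (-x) - Real.exp (-y)| ≤ |x - y| := by
  have key : ∀ {u v : ℝ}, 0 ≤ u → u ≤ v → |Real.exp (-u) - Real.exp (-v)| ≤ |u - v| := by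
    intro u v hu huv
    have h1 : Real.exp (-v) ≤ Real.exp (-u) := Real.exp_le_exp.2 (by linarith)
    have h2 : Real.exp (-v) = Real.exp (-u) * Real.exp (-(v - u)) := by
      rw [← Real.exp_add]
      ring_nf
    have h3 := Real.add_one_le_exp (-(v - u))
    have h4 : Real.exp (-u) ≤ 1 := Real.exp_le_one_iff.2 (by linarith)
    have h5 := Real.exp_pos (-u)
    rw [abs_of_nonneg (by linarith), abs_of_nonpos (by linarith), h2]
    nlinarith
  rcases le_total x y with h | h
  · exact key hx h
  · rw [abs_sub_comm, abs_sub_comm x]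
    exact key hy h

variable {Ω X : Type*} [MeasurableSpace Ω] [MetricSpace X] [MeasurableSpace X] [BorelSpace X]
  {R : RandomSystem Ω X} {P : Measure Ω} [IsProbabilityMeasure P] {κ : Kernel Ω X}
  [IsMarkovKernel κ] {C : Ω → ℝ} {C₀ : ℝ} {γ : ℕ → ℝ}

/-- Mean error in the exponential law for the ball `B(y, r)` at time `n`. Here `g` is the gap after
which correlations are used, `ρ` the width of the annulus, `h` a uniform bound for the sample
measures of the ball, `σ` the probability of a short return, `α` the measure of the annulus and `W`
the decay beyond the gap; `η` is free. -/
lemma FiberedDecay.integral_abs_noHit_sub_exp_le (h3 : FiberedDecay R P κ C γ)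
    (h1 : AnnealedDecay R P κ (P.compProd κ).snd C₀ γ) (hR : R.IsStationary P κ) {p : ℝ}
    (hp : 0 < p) (hp1 : p ≤ 1) (hC : Integrable (fun ω => |C ω| ^ p) P) {y : X}
    {r ρ h σ α W η : ℝ} (hρ : 0 < ρ) (hh0 : 0 ≤ h)
    (hh : ∀ᵐ ω ∂P, (κ ω).real (Metric.ball y r) ≤ h) {g : ℕ} (hg : 1 ≤ g)
    (hσ : (P.compProd κ).real
      {z | z.2 ∈ Metric.ball y r ∧ z.2 ∉ R.noHit (Metric.ball y r) g z.1} ≤ σ)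
    (hα : (P.compProd κ).snd.real (Metric.ball y (r + ρ))
      - (P.compProd κ).snd.real (Metric.ball y r) ≤ α)
    (hW : ∀ ℓ, g ≤ ℓ → |γ ℓ| * ρ⁻¹ ≤ W) (hη : 0 < η) (n : ℕ) :
    ∫ ω, |(κ ω).real (R.noHit (Metric.ball y r) n ω)
      - Real.exp (-(n * (P.compProd κ).snd.real (Metric.ball y r)))| ∂P
    ≤ n * (σ + (P.compProd κ).snd.real (Metric.ball y r) * (g * h) + α
        + (∫ ω, |C ω| ^ p ∂P) * W ^ p + h * (P.compProd κ).snd.real (Metric.ball y r))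
      + η + (n * (2 * g * (h * (P.compProd κ).snd.real (Metric.ball y r)))
        + n ^ 2 * (2 * α + |C₀| * W + (∫ ω, |C ω| ^ p ∂P) * W ^ p)) / η := by
  have hE := fun m => h3.integral_abs_inter_noHit_sub_le hR hp hp1 hC hρ hh hg m
  have hcorr := fun ℓ (hℓ : g ≤ ℓ) =>
    h3.integral_real_mul_real_le h1 hR hp hp1 hC y r hρ (hg.trans hℓ)
  set A := Metric.ball y r with hAdef
  set ε := (P.compProd κ).snd.real A with hε
  set K := ∫ ω, |C ω| ^ p ∂P with hK
  have hA : MeasurableSet A := measurableSet_ball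
  have ma := measurable_kernel_real (κ := κ) hA
  have hK0 : 0 ≤ K := integral_nonneg fun ω => Real.rpow_nonneg (abs_nonneg _) _
  have hε0 : 0 ≤ ε := measureReal_nonneg
  have hW0 : 0 ≤ W := (mul_nonneg (abs_nonneg _) (inv_nonneg.2 hρ.le)).trans (hW g le_rfl)
  have hWp : ∀ ℓ, g ≤ ℓ → K * (|γ ℓ| * ρ⁻¹) ^ p ≤ K * W ^ p := fun ℓ hℓ =>
    mul_le_mul_of_nonneg_left (Real.rpow_le_rpow
      (mul_nonneg (abs_nonneg _) (inv_nonneg.2 hρ.le)) (hW ℓ hℓ) hp.le) hK0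
  have hα0 : 0 ≤ α := le_trans (sub_nonneg.2
    (measureReal_mono (Metric.ball_subset_ball (by linarith)))) hα
  have bound1 : ∀ ω, |(κ ω).real A| ≤ 1 := fun ω => by
    rw [abs_of_nonneg measureReal_nonneg]
    exact measureReal_le_one
  have ia : Integrable (fun ω => (κ ω).real A) P := integrable_of_abs_le ma bound1
  have hmean : ∫ ω, (κ ω).real A ∂P = ε := integral_kernel_real hA
  have iprod : ∀ ℓ, Integrable (fun ω => (κ ω).real A * (κ (R.θ^[ℓ] ω)).real A) P := fun ℓ =>
    integrable_of_abs_le (B := 1) (ma.mul (ma.comp (RandomSystem.measurable_iterate_base ℓ)))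
      fun ω => by
        rw [abs_mul]
        exact mul_le_one₀ (bound1 ω) (abs_nonneg _) (bound1 _)
  have hprod : ∀ ℓ, ∫ ω, (κ ω).real A * (κ (R.θ^[ℓ] ω)).real A ∂P ≤ h * ε := by
    intro ℓ
    rw [← hmean, ← integral_const_mul]
    refine integral_mono_ae (iprod ℓ) (ia.const_mul h) ?_
    filter_upwards [(hR.base_iterate ℓ).quasiMeasurePreserving.ae hh] with ω hω
    rw [mul_comm h]
    exact mul_le_mul_of_nonneg_left hω measureReal_nonneg
  -- first comparison: with the exponential of minus the accumulated sample measure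
  have hcomp := hR.integral_abs_real_noHit_sub_exp_le hA hE n
  have hsq : ∫ ω, (κ ω).real A ^ 2 ∂P ≤ h * ε := by
    simpa [sq] using hprod 0
  -- second comparison: concentration of the accumulated sample measure
  have mu : Measurable fun ω => (κ ω).real A - ε := ma.sub_const _
  have hcov : ∀ ℓ, ∫ ω, ((κ ω).real A - ε) * ((κ (R.θ^[ℓ] ω)).real A - ε) ∂P
      = ∫ ω, (κ ω).real A * (κ (R.θ^[ℓ] ω)).real A ∂P - ε ^ 2 := by
    intro ℓ
    have iaℓ : Integrable (fun ω => (κ (R.θ^[ℓ] ω)).real A) P :=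
      integrable_of_abs_le (ma.comp (RandomSystem.measurable_iterate_base ℓ)) fun ω => bound1 _
    have hexp : ∀ ω, ((κ ω).real A - ε) * ((κ (R.θ^[ℓ] ω)).real A - ε)
        = (κ ω).real A * (κ (R.θ^[ℓ] ω)).real A - ε * (κ ω).real A
          - (ε * (κ (R.θ^[ℓ] ω)).real A - ε ^ 2) := fun ω => by ring
    simp_rw [hexp]
    have j1 : Integrable (fun ω => (κ ω).real A * (κ (R.θ^[ℓ] ω)).real A - ε * (κ ω).real A) P :=
      (iprod ℓ).sub (ia.const_mul ε)
    have j2 : Integrable (fun ω => ε * (κ (R.θ^[ℓ] ω)).real A - ε ^ 2) P :=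
      (iaℓ.const_mul ε).sub (integrable_const _)
    rw [integral_sub j1 j2, integral_sub (iprod ℓ) (ia.const_mul ε),
      integral_sub (iaℓ.const_mul ε) (integrable_const _), integral_const_mul,
      integral_const_mul, hR.integral_iterate ℓ _ ma, hmean]
    simp
    ring
  have hub : ∀ ω, |(κ ω).real A - ε| ≤ 1 := fun ω => by
    have e1 : ε ≤ 1 := measureReal_le_one
    have e2 : (κ ω).real A ≤ 1 := measureReal_le_one
    have e3 : 0 ≤ (κ ω).real A := measureReal_nonneg
    rw [abs_le]
    constructor <;> linarith
  have hvar := integral_sq_sum_iterate_le hR.base mu hub (s := h * ε)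
    (w := 2 * α + |C₀| * W + K * W ^ p) (by positivity) (by positivity) (g := g)
    (fun ℓ => by rw [hcov]; nlinarith [hprod ℓ, sq_nonneg ε])
    (fun ℓ hℓ => by
      rw [hcov]
      have e1 := hcorr ℓ hℓ
      have e2 := mul_le_mul_of_nonneg_left (hW ℓ hℓ) (abs_nonneg C₀)
      have e3 := hWp ℓ hℓ
      linarith) n
  have mS : Measurable fun ω => ∑ i ∈ Finset.range n, (κ (R.θ^[i + 1] ω)).real A :=
    Finset.measurable_sum _ fun i _ => ma.comp (RandomSystem.measurable_iterate_base (i + 1))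
  have mdev : Measurable fun ω => ∑ i ∈ Finset.range n, ((κ (R.θ^[i + 1] ω)).real A - ε) :=
    Finset.measurable_sum _ fun i _ => mu.comp (RandomSystem.measurable_iterate_base (i + 1))
  have mV := hR.measurable_real_noHit hA n
  have hexp1 : ∀ {x : ℝ}, 0 ≤ x → Real.exp (-x) ≤ 1 := fun hx =>
    Real.exp_le_one_iff.2 (neg_nonpos.2 hx)
  have habs : ∀ {x y : ℝ}, 0 ≤ x → x ≤ 1 → 0 ≤ y → y ≤ 1 → |x - y| ≤ 1 := by
    intro x y hx hx1 hy hy1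
    rw [abs_le]
    constructor <;> linarith
  have i0 : Integrable (fun ω => |(κ ω).real (R.noHit A n ω) - Real.exp (-(n * ε))|) P :=
    integrable_of_abs_le (B := 1) (mV.sub_const _).abs fun ω => by
      rw [abs_abs]
      exact habs measureReal_nonneg measureReal_le_one (Real.exp_pos _).le
        (hexp1 (by positivity))
  have i1 : Integrable (fun ω => |(κ ω).real (R.noHit A n ω)
      - Real.exp (-∑ i ∈ Finset.range n, (κ (R.θ^[i + 1] ω)).real A)|) P :=
    integrable_of_abs_le (B := 1) (mV.sub (Real.measurable_exp.comp mS.neg)).abs fun ω => by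
      rw [abs_abs]
      exact habs measureReal_nonneg measureReal_le_one (Real.exp_pos _).le
        (hexp1 (Finset.sum_nonneg fun _ _ => measureReal_nonneg))
  have i2 : Integrable (fun ω =>
      (∑ i ∈ Finset.range n, ((κ (R.θ^[i + 1] ω)).real A - ε)) ^ 2 / η) P := by
    refine Integrable.div_const ?_ η
    refine integrable_of_abs_le (B := (n : ℝ) ^ 2) (mdev.pow_const 2) fun ω => ?_
    rw [abs_pow]
    refine pow_le_pow_left₀ (abs_nonneg _) ?_ 2
    refine (Finset.abs_sum_le_sum_abs _ _).trans ((Finset.sum_le_sum fun i _ => hub _).trans ?_)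
    simp
  have hpt : ∀ ω, |(κ ω).real (R.noHit A n ω) - Real.exp (-(n * ε))|
      ≤ |(κ ω).real (R.noHit A n ω)
          - Real.exp (-∑ i ∈ Finset.range n, (κ (R.θ^[i + 1] ω)).real A)|
        + (η + (∑ i ∈ Finset.range n, ((κ (R.θ^[i + 1] ω)).real A - ε)) ^ 2 / η) := by
    intro ω
    have e1 := abs_exp_neg_sub_exp_neg_le (y := n * ε)
      (Finset.sum_nonneg fun i (_ : i ∈ Finset.range n) =>
        (measureReal_nonneg : 0 ≤ (κ (R.θ^[i + 1] ω)).real A)) (by positivity)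
    have e2 : ∑ i ∈ Finset.range n, (κ (R.θ^[i + 1] ω)).real A - n * ε
        = ∑ i ∈ Finset.range n, ((κ (R.θ^[i + 1] ω)).real A - ε) := by
      rw [Finset.sum_sub_distrib]
      simp
    rw [e2] at e1
    set D := ∑ i ∈ Finset.range n, ((κ (R.θ^[i + 1] ω)).real A - ε)
    have e3 : |D| ≤ η + D ^ 2 / η := by
      rw [← sq_abs, ← sub_le_iff_le_add', le_div_iff₀ hη]
      nlinarith [sq_nonneg (|D| - η), abs_nonneg D]
    exact (abs_sub_le _ _ _).trans (add_le_add le_rfl (e1.trans e3))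
  have hfin := integral_mono i0 (i1.add ((integrable_const η).add i2)) hpt
  rw [integral_add' i1 ((integrable_const η).add i2), integral_add' (integrable_const η) i2,
    integral_div] at hfin
  simp only [integral_const, probReal_univ, one_smul] at hfin
  have hvar' := div_le_div_of_nonneg_right hvar hη.le
  have hn0 : (0 : ℝ) ≤ n := n.cast_nonneg
  have hcomp' := hcomp.trans (mul_le_mul_of_nonneg_left (add_le_add (add_le_add (add_le_add
    (add_le_add hσ (le_refl (ε * (g * h)))) hα) (hWp g le_rfl)) hsq) hn0)
  linarith

end Quantitative

/-! ### Recurrence is slow -/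

section Recurrence

lemma SuperPolyDecay.exists_pow_mul_abs_le {γ : ℕ → ℝ} (hγ : SuperPolyDecay γ) (k : ℕ) :
    ∃ G, 0 ≤ G ∧ ∀ ℓ : ℕ, (ℓ : ℝ) ^ k * |γ ℓ| ≤ G := by
  obtain ⟨G, hG⟩ := (hγ k).abs.bddAbove_range
  have h : ∀ ℓ : ℕ, (ℓ : ℝ) ^ k * |γ ℓ| ≤ G := fun ℓ => by
    have := hG ⟨ℓ, rfl⟩
    simpa [abs_mul] using this
  exact ⟨G, (by positivity : (0 : ℝ) ≤ ((0 : ℕ) : ℝ) ^ k * |γ 0|).trans (h 0), h⟩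

lemma AnnulusRegular.measure_closedBall {X : Type*} [MetricSpace X] [MeasurableSpace X] {μ : Measure X}
    [IsFiniteMeasure μ] {a b : ℝ} (ha : 0 < a)
    (h4 : AnnulusRegular μ a b) (y : X) {r : ℝ} (hr : 0 < r) :
    μ (Metric.closedBall y r) = μ (Metric.ball y r) := by
  refine le_antisymm ?_ (measure_mono Metric.ball_subset_closedBall)
  rw [← ofReal_measureReal, ← ofReal_measureReal]
  refine ENNReal.ofReal_le_ofReal ?_
  have hlim : Tendsto (fun ρ : ℝ => μ.real (Metric.ball y r) + r ^ (-b) * ρ ^ a) (𝓝[>] 0)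
      (𝓝 (μ.real (Metric.ball y r) + r ^ (-b) * 0)) := by
    refine tendsto_const_nhds.add (Tendsto.const_mul _ ?_)
    have := (Real.continuousAt_rpow_const 0 a (Or.inr ha.le)).tendsto
    rw [Real.zero_rpow ha.ne'] at this
    exact this.mono_left nhdsWithin_le_nhds
  rw [mul_zero, add_zero] at hlim
  refine ge_of_tendsto hlim ?_
  filter_upwards [self_mem_nhdsWithin] with ρ hρ
  exact (measureReal_mono (Metric.closedBall_subset_ball (by
    have : (0 : ℝ) < ρ := hρ
    linarith))).trans (h4 y r ρ hr hρ)

lemma UniformBallBound.const_nonneg {Ω X : Type*} [MeasurableSpace Ω] [MetricSpace X]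
    [MeasurableSpace X] {P : Measure Ω} [IsProbabilityMeasure P] {κ : Kernel Ω X} [IsMarkovKernel κ]
    {c d₀ : ℝ} (h2 : UniformBallBound P κ c d₀) : 0 ≤ c := by
  obtain ⟨ω, hω⟩ := h2.exists
  obtain ⟨x⟩ : Nonempty X := nonempty_of_isProbabilityMeasure (κ ω)
  have h0 : 0 ≤ (κ ω).real (Metric.ball x 1) := measureReal_nonneg
  simpa using h0.trans (hω x 1 one_pos)

variable {Ω X : Type*} [MeasurableSpace Ω] [MetricSpace X] [MeasurableSpace X] [BorelSpace X]
  {R : RandomSystem Ω X} {P : Measure Ω} [IsProbabilityMeasure P] {κ : Kernel Ω X}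
  [IsMarkovKernel κ] {C₀ : ℝ} {γ : ℕ → ℝ} {c d₀ : ℝ}

lemma UniformBallBound.real_snd_ball_le (h2 : UniformBallBound P κ c d₀) (x : X) {r : ℝ}
    (hr : 0 < r) : (P.compProd κ).snd.real (Metric.ball x r) ≤ c * r ^ d₀ := by
  rw [← integral_kernel_real measurableSet_ball]
  have hle : ∀ᵐ ω ∂P, (κ ω).real (Metric.ball x r) ≤ c * r ^ d₀ := by
    filter_upwards [h2] with ω hω
    exact hω x r hr
  have h := integral_mono_ae (integrable_of_abs_le (B := 1)
    (measurable_kernel_real (κ := κ) measurableSet_ball) fun ω => by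
      rw [abs_of_nonneg measureReal_nonneg]
      exact measureReal_le_one) (integrable_const (c * r ^ d₀)) hle
  simpa using h

/-- The probability that an orbit comes back `2r`-close to its starting point at time `ℓ`. -/
lemma AnnealedDecay.exists_real_dist_lt_le [CompactSpace X] [HasBesicovitchCovering X]
    (h1 : AnnealedDecay R P κ (P.compProd κ).snd C₀ γ) (hR : R.IsStationary P κ)
    (h2 : UniformBallBound P κ c d₀) :
    ∃ (D : ℕ) (B : ℝ), 0 ≤ B ∧ ∀ (r : ℝ) (ℓ : ℕ), 0 < r → r ≤ 1 → 1 ≤ ℓ →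
      (P.compProd κ).real {z | dist (R.iter ℓ z.1 z.2) z.2 < 2 * r}
        ≤ B * (r ^ d₀ + |γ ℓ| * (r ^ (D + 1))⁻¹) := by
  obtain ⟨M, D, B, hB, hnet⟩ := exists_net (X := X)
  have hc := h2.const_nonneg
  refine ⟨D, max (M * (c * 3 ^ d₀)) (B * |C₀|), le_max_of_le_right (by positivity),
    fun r ℓ hr hr1 hℓ => ?_⟩
  obtain ⟨T, hT, hTB, hTM⟩ := hnet r hr hr1
  have hcov : {z : Ω × X | dist (R.iter ℓ z.1 z.2) z.2 < 2 * r}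
      ⊆ ⋃ t ∈ T, {z | z.2 ∈ Metric.ball t r ∧ R.iter ℓ z.1 z.2 ∈ Metric.ball t (3 * r)} := by
    intro z hz
    obtain ⟨t, ht, hzt⟩ := hT z.2
    refine Set.mem_iUnion₂.2 ⟨t, ht, hzt, ?_⟩
    have hz' : dist (R.iter ℓ z.1 z.2) z.2 < 2 * r := hz
    rw [Metric.mem_ball]
    linarith [dist_triangle (R.iter ℓ z.1 z.2) z.2 t]
  have hoverlap : ∑ t ∈ T, (P.compProd κ).snd.real (Metric.ball t (r + r)) ≤ M := by
    have i1 : ∀ t ∈ T, Integrable ((Metric.ball t (r + r)).indicator (1 : X → ℝ))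
        (P.compProd κ).snd := fun t _ => (integrable_const 1).indicator measurableSet_ball
    calc ∑ t ∈ T, (P.compProd κ).snd.real (Metric.ball t (r + r))
        = ∫ x, ∑ t ∈ T, (Metric.ball t (r + r)).indicator (1 : X → ℝ) x
            ∂(P.compProd κ).snd := by
          rw [integral_finsetSum _ i1]
          exact Finset.sum_congr rfl fun t _ =>
            (integral_indicator_one measurableSet_ball).symm
      _ ≤ ∫ _x, (M : ℝ) ∂(P.compProd κ).snd := by
          refine integral_mono (integrable_finsetSum _ i1) (integrable_const _) fun x => ?_
          have : ∑ t ∈ T, (Metric.ball t (r + r)).indicator (1 : X → ℝ) x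
              = ((T.filter fun t => dist x t < 2 * r).card : ℝ) := by
            rw [Finset.card_filter, Nat.cast_sum]
            refine Finset.sum_congr rfl fun t _ => ?_
            have hx : x ∈ Metric.ball t (r + r) ↔ dist x t < 2 * r := by
              rw [Metric.mem_ball, two_mul]
            by_cases h : dist x t < 2 * r
            · rw [Set.indicator_of_mem (hx.2 h), if_pos h, Pi.one_apply, Nat.cast_one]
            · rw [Set.indicator_of_notMem (mt hx.1 h), if_neg h, Nat.cast_zero]
          simp only [this]
          exact_mod_cast hTM x
      _ = M := by simp
  calc (P.compProd κ).real {z | dist (R.iter ℓ z.1 z.2) z.2 < 2 * r}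
      ≤ ∑ t ∈ T, (P.compProd κ).real
          {z | z.2 ∈ Metric.ball t r ∧ R.iter ℓ z.1 z.2 ∈ Metric.ball t (3 * r)} :=
        (measureReal_mono hcov (measure_ne_top _ _)).trans (measureReal_biUnion_finset_le _ _)
    _ ≤ ∑ t ∈ T, ((P.compProd κ).snd.real (Metric.ball t (r + r)) * (c * (3 * r) ^ d₀)
          + |C₀| * (|γ ℓ| * r⁻¹)) := by
        refine Finset.sum_le_sum fun t _ =>
          (h1.real_inter_le hR hℓ t r hr measurableSet_ball).trans ?_
        gcongr
        exact h2.real_snd_ball_le t (by positivity)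
    _ = (∑ t ∈ T, (P.compProd κ).snd.real (Metric.ball t (r + r))) * (c * (3 * r) ^ d₀)
          + T.card * (|C₀| * (|γ ℓ| * r⁻¹)) := by
        rw [Finset.sum_add_distrib, ← Finset.sum_mul, Finset.sum_const, nsmul_eq_mul]
    _ ≤ M * (c * (3 * r) ^ d₀) + (B * (r ^ D)⁻¹) * (|C₀| * (|γ ℓ| * r⁻¹)) := by
        gcongr
        rw [← div_eq_mul_inv, le_div_iff₀ (by positivity)]
        exact hTB
    _ = M * (c * 3 ^ d₀) * r ^ d₀ + B * |C₀| * (|γ ℓ| * (r ^ (D + 1))⁻¹) := by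
        rw [Real.mul_rpow (by norm_num) hr.le, pow_succ, mul_inv]
        ring
    _ ≤ _ := by
        rw [mul_add]
        gcongr
        · exact le_max_left _ _
        · exact le_max_right _ _

/-- Almost every orbit returns close to its starting point at most at a polynomial rate: the decay of
correlations controls the late times through the Borel-Cantelli lemma, aperiodicity the early
ones. -/
lemma AnnealedDecay.exists_ae_pow_mul_dist_ge [CompactSpace X] [HasBesicovitchCovering X]
    (h1 : AnnealedDecay R P κ (P.compProd κ).snd C₀ γ) (hR : R.IsStationary P κ)
    (h2 : UniformBallBound P κ c d₀) (hγ : SuperPolyDecay γ)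
    (h5 : ∀ᵐ z ∂(P.compProd κ), ∀ n : ℕ, 1 ≤ n → R.iter n z.1 z.2 ≠ z.2)
    {β : ℕ} (hβ : 2 ≤ β * d₀) :
    ∀ᵐ z ∂(P.compProd κ), ∃ m : ℕ, ∀ ℓ : ℕ, 1 ≤ ℓ →
      1 / ((m : ℝ) + 1) ≤ (ℓ : ℝ) ^ β * dist (R.iter ℓ z.1 z.2) z.2 := by
  obtain ⟨D, B, hB, hdist⟩ := h1.exists_real_dist_lt_le hR h2
  obtain ⟨G, hG0, hG⟩ := hγ.exists_pow_mul_abs_le (β * (D + 1) + 2)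
  let bad : ℕ → Set (Ω × X) := fun k =>
    {z | dist (R.iter (k + 1) z.1 z.2) z.2 < 2 * (((k + 1 : ℕ) : ℝ) ^ β)⁻¹}
  have hbad : ∀ k, (P.compProd κ) (bad k)
      ≤ ENNReal.ofReal (B * (1 + G) * (1 / ((k + 1 : ℕ) : ℝ) ^ 2)) := by
    intro k
    set l : ℝ := ((k + 1 : ℕ) : ℝ) with hl
    have hl1 : 1 ≤ l := by rw [hl]; exact_mod_cast Nat.succ_le_succ (Nat.zero_le k)
    have hl0 : 0 < l := by linarith
    have hb := hdist ((l ^ β)⁻¹) (k + 1) (by positivity)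
      (inv_le_one_of_one_le₀ (one_le_pow₀ hl1)) (by omega)
    have e1 : ((l ^ β)⁻¹) ^ d₀ ≤ 1 / l ^ 2 := by
      rw [Real.inv_rpow (by positivity), ← Real.rpow_natCast, ← Real.rpow_mul hl0.le, one_div]
      refine inv_anti₀ (by positivity) ?_
      rw [← Real.rpow_natCast l 2]
      exact Real.rpow_le_rpow_of_exponent_le hl1 (by exact_mod_cast hβ)
    have e2 : |γ (k + 1)| * ((((l ^ β)⁻¹)) ^ (D + 1))⁻¹ ≤ G * (1 / l ^ 2) := by
      rw [← inv_pow, inv_inv, ← pow_mul, mul_one_div, le_div_iff₀ (by positivity)]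
      calc |γ (k + 1)| * l ^ (β * (D + 1)) * l ^ 2
          = l ^ (β * (D + 1) + 2) * |γ (k + 1)| := by ring
        _ ≤ G := hG (k + 1)
    rw [← ofReal_measureReal]
    refine ENNReal.ofReal_le_ofReal (hb.trans ?_)
    rw [mul_assoc B]
    refine mul_le_mul_of_nonneg_left ?_ hB
    linarith
  have hsum : ∑' k, (P.compProd κ) (bad k) ≠ ∞ := by
    refine ne_top_of_le_ne_top ?_ (ENNReal.tsum_le_tsum hbad)
    rw [← ENNReal.ofReal_tsum_of_nonneg (fun k => by positivity)]
    · exact ENNReal.ofReal_ne_top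
    · exact ((summable_nat_add_iff 1).2
        (Real.summable_one_div_nat_pow.2 one_lt_two)).mul_left _
  filter_upwards [ae_eventually_notMem hsum, h5] with z hz h5z
  obtain ⟨k₀, hk₀⟩ := eventually_atTop.1 hz
  -- a positive lower bound for the finitely many early times
  have hearly : ∃ e : ℝ, 0 < e ∧ ∀ ℓ : ℕ, 1 ≤ ℓ → ℓ ≤ k₀ →
      e ≤ (ℓ : ℝ) ^ β * dist (R.iter ℓ z.1 z.2) z.2 := by
    have hpos : ∀ ℓ : ℕ, 1 ≤ ℓ → 0 < (ℓ : ℝ) ^ β * dist (R.iter ℓ z.1 z.2) z.2 := fun ℓ hℓ =>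
      mul_pos (pow_pos (by exact_mod_cast hℓ) _) (dist_pos.2 (h5z ℓ hℓ))
    generalize k₀ = k
    induction k with
    | zero => exact ⟨1, one_pos, fun ℓ h h' => absurd h (by omega)⟩
    | succ k ih =>
      obtain ⟨e, he, h⟩ := ih
      refine ⟨min e (((k + 1 : ℕ) : ℝ) ^ β * dist (R.iter (k + 1) z.1 z.2) z.2),
        lt_min he (hpos _ (by omega)), fun ℓ hℓ hℓk => ?_⟩
      rcases Nat.lt_or_ge ℓ (k + 1) with hlt | hge
      · exact (min_le_left _ _).trans (h ℓ hℓ (by omega))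
      · obtain rfl : ℓ = k + 1 := by omega
        exact min_le_right _ _
  obtain ⟨e, he, hearly⟩ := hearly
  obtain ⟨m, hm⟩ := exists_nat_one_div_lt (lt_min he one_pos)
  refine ⟨m, fun ℓ hℓ => ?_⟩
  rcases le_or_gt ℓ k₀ with hle | hgt
  · exact hm.le.trans ((min_le_left _ _).trans (hearly ℓ hℓ hle))
  · obtain ⟨k, rfl⟩ := Nat.exists_eq_succ_of_ne_zero (by omega : ℓ ≠ 0)
    have hk : ¬ dist (R.iter (k + 1) z.1 z.2) z.2 < 2 * (((k + 1 : ℕ) : ℝ) ^ β)⁻¹ :=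
      hk₀ k (by omega)
    have hl0 : (0 : ℝ) < ((k + 1 : ℕ) : ℝ) ^ β := by positivity
    refine (hm.le.trans (min_le_right _ _)).trans ?_
    rw [not_lt, ← div_eq_mul_inv, div_le_iff₀ hl0] at hk
    rw [Nat.succ_eq_add_one, mul_comm]
    linarith

/-- Around almost every point `y`, a short return to `B(y, r)` has conditional probability tending to
`0`: by the Besicovitch differentiation theorem, the conditional probability of a point with fast
recurrence tends to a density which is small for small recurrence constants. -/
lemma RandomSystem.IsStationary.ae_eventually_short_return_le [CompactSpace X]
    [HasBesicovitchCovering X] (hR : R.IsStationary P κ) {a b : ℝ} (ha : 0 < a)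
    (h4 : AnnulusRegular (P.compProd κ).snd a b) {β : ℕ}
    (hrec : ∀ᵐ z ∂(P.compProd κ), ∃ m : ℕ, ∀ ℓ : ℕ, 1 ≤ ℓ →
      1 / ((m : ℝ) + 1) ≤ (ℓ : ℝ) ^ β * dist (R.iter ℓ z.1 z.2) z.2)
    {g : ℝ → ℕ} (hg : Tendsto (fun r => (g r : ℝ) ^ β * (2 * r)) (𝓝[>] 0) (𝓝 0)) :
    ∀ᵐ y ∂(P.compProd κ).snd, ∀ η : ℝ, 0 < η → ∀ᶠ r in 𝓝[>] 0, (P.compProd κ).real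
      {z | z.2 ∈ Metric.ball y r ∧ z.2 ∉ R.noHit (Metric.ball y r) (g r) z.1}
        ≤ η * (P.compProd κ).snd.real (Metric.ball y r) := by
  set ν := P.compProd κ with hν
  set μ := ν.snd with hμ
  -- the points with recurrence constant below `1 / (m + 1)`
  let N : ℕ → Set (Ω × X) := fun m =>
    {z | ∃ ℓ : ℕ, 1 ≤ ℓ ∧ (ℓ : ℝ) ^ β * dist (R.iter ℓ z.1 z.2) z.2 < 1 / ((m : ℝ) + 1)}
  have hNm : ∀ m, MeasurableSet (N m) := by
    intro m
    have hN : N m = ⋃ (ℓ : ℕ) (_ : 1 ≤ ℓ), {z : Ω × X |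
        (ℓ : ℝ) ^ β * dist (R.iter ℓ z.1 z.2) z.2 < 1 / ((m : ℝ) + 1)} := by
      ext z
      simp [N]
    rw [hN]
    exact MeasurableSet.iUnion fun ℓ => MeasurableSet.iUnion fun _ =>
      measurableSet_lt (((hR.measurable_iter ℓ).dist measurable_snd).const_mul _) measurable_const
  have hNanti : Antitone N := by
    rintro m n hmn z ⟨ℓ, hℓ, hz⟩
    exact ⟨ℓ, hℓ, hz.trans_le (one_div_le_one_div_of_le (by positivity) (by
      have : (m : ℝ) ≤ n := by exact_mod_cast hmn
      linarith))⟩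
  have hNlim : Tendsto (fun m => ν (N m)) atTop (𝓝 0) := by
    have h0 : ν (⋂ m, N m) = 0 := by
      refine measure_mono_null (fun z hz => ?_) (ae_iff.1 hrec)
      simp only [Set.mem_ofPred_eq, not_exists, not_forall, not_le]
      intro m
      obtain ⟨ℓ, hℓ, h⟩ := Set.mem_iInter.1 hz m
      exact ⟨ℓ, hℓ, h⟩
    rw [← h0]
    exact tendsto_measure_iInter_atTop (fun m => (hNm m).nullMeasurableSet) hNanti
      ⟨0, measure_ne_top _ _⟩
  let τ : ℕ → Measure X := fun m => (ν.restrict (N m)).snd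
  have hτ : ∀ m {s : Set X}, MeasurableSet s → τ m s = ν ({z | z.2 ∈ s} ∩ N m) := fun m s hs => by
    rw [show τ m s = _ from Measure.snd_apply hs, Measure.restrict_apply (measurable_snd hs)]
    rfl
  have hτμ : ∀ m, τ m ≪ μ := fun m => by
    refine Measure.AbsolutelyContinuous.mk fun s hs h => ?_
    rw [hτ m hs]
    refine measure_mono_null Set.inter_subset_left ?_
    rwa [hμ, Measure.snd_apply hs] at h
  have hdens : ∀ᵐ y ∂μ, ⨅ m, (τ m).rnDeriv μ y = 0 := by
    have hmeas : Measurable fun y => ⨅ m, (τ m).rnDeriv μ y :=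
      Measurable.iInf fun m => Measure.measurable_rnDeriv _ _
    refine (lintegral_eq_zero_iff hmeas).1 (le_antisymm ?_ zero_le)
    refine ge_of_tendsto' hNlim fun m => ?_
    calc ∫⁻ y, ⨅ m, (τ m).rnDeriv μ y ∂μ ≤ ∫⁻ y, (τ m).rnDeriv μ y ∂μ :=
          lintegral_mono fun y => iInf_le _ m
      _ ≤ τ m Set.univ := Measure.lintegral_rnDeriv_le
      _ ≤ ν (N m) := by
          rw [hτ m MeasurableSet.univ]
          exact measure_mono Set.inter_subset_right
  have hdiff : ∀ᵐ y ∂μ, ∀ m, Tendsto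
      (fun r => τ m (Metric.closedBall y r) / μ (Metric.closedBall y r)) (𝓝[>] 0)
      (𝓝 ((τ m).rnDeriv μ y)) :=
    ae_all_iff.2 fun m => Besicovitch.ae_tendsto_rnDeriv _ _
  filter_upwards [hdens, hdiff] with y hy0 hy η hη
  have hlt : ⨅ m, (τ m).rnDeriv μ y < ENNReal.ofReal η := by
    rw [hy0]
    exact ENNReal.ofReal_pos.2 hη
  obtain ⟨m, hm⟩ := iInf_lt_iff.1 hlt
  filter_upwards [(hy m).eventually_lt_const hm, self_mem_nhdsWithin,
    hg.eventually_lt_const (by positivity : (0 : ℝ) < 1 / ((m : ℝ) + 1))] with r hr hr0 hgr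
  have hr0' : (0 : ℝ) < r := hr0
  have hclosed : τ m (Metric.closedBall y r) ≤ ENNReal.ofReal η * μ (Metric.closedBall y r) := by
    by_cases h0 : μ (Metric.closedBall y r) = 0
    · rw [hτμ m h0]
      exact zero_le
    · exact (ENNReal.div_le_iff h0 (measure_ne_top _ _)).1 hr.le
  rw [h4.measure_closedBall ha y hr0'] at hclosed
  -- a short return to the ball forces a small recurrence constant
  have hsub : {z : Ω × X | z.2 ∈ Metric.ball y r ∧ z.2 ∉ R.noHit (Metric.ball y r) (g r) z.1}
      ⊆ {z | z.2 ∈ Metric.closedBall y r} ∩ N m := by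
    rintro z ⟨hz, hzn⟩
    refine ⟨Metric.ball_subset_closedBall hz, ?_⟩
    simp only [RandomSystem.noHit, Set.mem_ofPred_eq, not_forall, not_not] at hzn
    obtain ⟨k, hk1, hkg, hk⟩ := hzn
    refine ⟨k, hk1, lt_of_le_of_lt ?_ hgr⟩
    have hd : dist (R.iter k z.1 z.2) z.2 ≤ 2 * r := by
      rw [Metric.mem_ball] at hz hk
      linarith [dist_triangle_right (R.iter k z.1 z.2) z.2 y]
    gcongr
  have hfin := (measure_mono hsub).trans
    (((hτ m Metric.isClosed_closedBall.measurableSet).symm.le).trans hclosed)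
  have := ENNReal.toReal_mono (ENNReal.mul_ne_top ENNReal.ofReal_ne_top (measure_ne_top _ _)) hfin
  rwa [ENNReal.toReal_mul, ENNReal.toReal_ofReal hη.le] at this

end Recurrence

/-! ### Scales, and the exponential law in the mean -/

section Scales

lemma tendsto_rpow_nhdsGT_zero {s : ℝ} (hs : 0 < s) :
    Tendsto (fun r : ℝ => r ^ s) (𝓝[>] 0) (𝓝 0) := by
  have := (Real.continuousAt_rpow_const 0 s (Or.inr hs.le)).tendsto
  rw [Real.zero_rpow hs.ne'] at this
  exact this.mono_left nhdsWithin_le_nhds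

lemma natCeil_rpow_neg_le {r δ : ℝ} (hr : 0 < r) (hr1 : r ≤ 1) (hδ : 0 ≤ δ) :
    (⌈r ^ (-δ)⌉₊ : ℝ) ≤ 2 * r ^ (-δ) := by
  have h1 : 1 ≤ r ^ (-δ) := Real.one_le_rpow_of_pos_of_le_one_of_nonpos hr hr1 (by linarith)
  have h2 := (Nat.ceil_lt_add_one (by linarith : 0 ≤ r ^ (-δ))).le
  linarith

/-- Bookkeeping: the error of the exponential law at time `n ≤ t / ε`, when the error terms are
bounded by multiples of `x` and `n x`, `n ^ 2 x` are of order `r`. -/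
lemma error_terms_le {n ε g v x r t s α W Wp G Gp C₀ K₀ η : ℝ} (hn : 0 ≤ n)
    (hg : 0 ≤ g) (hv : 0 ≤ v) (hC₀ : 0 ≤ C₀) (hK₀ : 0 ≤ K₀) (hs : 0 ≤ s) (hG : 0 ≤ G)
    (hGp : 0 ≤ Gp) (hη : 0 < η) (hnε : n * ε ≤ t) (hn1 : n * x ≤ t * r)
    (hn2 : n ^ 2 * x ≤ t ^ 2 * r) (hα : α ≤ x) (hW : W ≤ G * x) (hWp : Wp ≤ Gp * x) :
    n * (s * ε + ε * (g * v) + α + K₀ * Wp + v * ε) + η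
        + (n * (2 * g * (v * ε)) + n ^ 2 * (2 * α + C₀ * W + K₀ * Wp)) / η
      ≤ t * s + η + (t * (g * v) + t * (r * (1 + K₀ * Gp)) + t * v
        + (2 * (t * (g * v)) + t ^ 2 * (r * (2 + C₀ * G + K₀ * Gp))) / η) := by
  have hA : n * (s * ε + ε * (g * v) + α + K₀ * Wp + v * ε)
      ≤ t * s + (t * (g * v) + t * (r * (1 + K₀ * Gp)) + t * v) := by
    calc n * (s * ε + ε * (g * v) + α + K₀ * Wp + v * ε)
        ≤ n * (s * ε + ε * (g * v) + x + K₀ * (Gp * x) + v * ε) := by gcongr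
      _ = (n * ε) * s + ((n * ε) * (g * v) + (n * x) * (1 + K₀ * Gp) + (n * ε) * v) := by ring
      _ ≤ t * s + (t * (g * v) + (t * r) * (1 + K₀ * Gp) + t * v) := by gcongr
      _ = _ := by ring
  have hB : n * (2 * g * (v * ε)) + n ^ 2 * (2 * α + C₀ * W + K₀ * Wp)
      ≤ 2 * (t * (g * v)) + t ^ 2 * (r * (2 + C₀ * G + K₀ * Gp)) := by
    calc n * (2 * g * (v * ε)) + n ^ 2 * (2 * α + C₀ * W + K₀ * Wp)
        ≤ n * (2 * g * (v * ε)) + n ^ 2 * (2 * x + C₀ * (G * x) + K₀ * (Gp * x)) := by gcongr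
      _ = 2 * ((n * ε) * (g * v)) + (n ^ 2 * x) * (2 + C₀ * G + K₀ * Gp) := by ring
      _ ≤ 2 * (t * (g * v)) + (t ^ 2 * r) * (2 + C₀ * G + K₀ * Gp) := by gcongr
      _ = _ := by ring
  have hB' := div_le_div_of_nonneg_right hB hη.le
  linarith

variable {Ω X : Type*} [MeasurableSpace Ω] [MetricSpace X] [CompactSpace X]
  [HasBesicovitchCovering X] [MeasurableSpace X] [BorelSpace X]
  {R : RandomSystem Ω X} {P : Measure Ω} [IsProbabilityMeasure P] {κ : Kernel Ω X}
  [IsMarkovKernel κ] {C : Ω → ℝ} {C₀ : ℝ} {γ : ℕ → ℝ} {c d₀ : ℝ}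

/-- Convergence in mean of the quenched survival probabilities at a fixed rescaled time. The gap is
`g = ⌈r ^ (-δ)⌉` with `δ` small enough for short returns to be negligible and for `g r ^ d₀ → 0`, and
the annulus has width `r ^ K` with `K` large; the superpolynomial decay beats all powers of `r`,
hence of `μ (B(y, r))`, the measure having finite upper local dimension. -/
lemma FiberedDecay.ae_tendsto_integral_abs_noHit_sub_exp (h3 : FiberedDecay R P κ C γ)
    (h1 : AnnealedDecay R P κ (P.compProd κ).snd C₀ γ) (hR : R.IsStationary P κ) {p : ℝ}
    (hp : 0 < p) (hp1 : p ≤ 1) (hC : Integrable (fun ω => |C ω| ^ p) P) (hγ : SuperPolyDecay γ)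
    (hd₀ : 0 < d₀) (h2 : UniformBallBound P κ c d₀) {a b : ℝ} (ha : 0 < a)
    (h4 : AnnulusRegular (P.compProd κ).snd a b)
    (h5 : ∀ᵐ z ∂(P.compProd κ), ∀ n : ℕ, 1 ≤ n → R.iter n z.1 z.2 ≠ z.2) :
    ∀ᵐ y ∂(P.compProd κ).snd, (∀ r, 0 < r → 0 < (P.compProd κ).snd.real (Metric.ball y r)) ∧
      ∀ t : ℝ, 0 ≤ t → Tendsto (fun r => ∫ ω, |(κ ω).real (R.noHit (Metric.ball y r)
            ⌊t / (P.compProd κ).snd.real (Metric.ball y r)⌋₊ ω)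
          - Real.exp (-(⌊t / (P.compProd κ).snd.real (Metric.ball y r)⌋₊
            * (P.compProd κ).snd.real (Metric.ball y r)))| ∂P) (𝓝[>] 0) (𝓝 0) := by
  obtain ⟨D, hD⟩ := exists_eventually_pow_le_measure_ball (X := X)
  have hc := h2.const_nonneg
  obtain ⟨β, hβ⟩ := exists_nat_ge (2 / d₀)
  have hβd : 2 ≤ β * d₀ := (div_le_iff₀ hd₀).1 hβ
  have hβ0 : (0 : ℝ) < β := by
    by_contra! h
    nlinarith
  set δ : ℝ := 1 / (2 * β) with hδdef
  have hδ : 0 < δ := by positivity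
  have hδd : δ < d₀ := by
    rw [hδdef, div_lt_iff₀ (by positivity)]
    linarith
  set g : ℝ → ℕ := fun r => ⌈r ^ (-δ)⌉₊ with hgdef
  have hsmall : ∀ᶠ r : ℝ in 𝓝[>] 0, 0 < r ∧ r ≤ 1 := by
    filter_upwards [Ioc_mem_nhdsGT one_pos] with r hr using hr
  -- `g ^ (2 β)` is at least `1 / r`, and `g ^ β` is of order `r ^ (-1/2)`
  have hpow : ∀ {r : ℝ}, 0 < r → (r ^ (-δ)) ^ (2 * β) = r⁻¹ := fun {r} hr => by
    rw [← Real.rpow_natCast, ← Real.rpow_mul hr.le, ← Real.rpow_neg_one]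
    congr 1
    rw [hδdef]
    push_cast
    field_simp
  have hpow' : ∀ {r : ℝ}, 0 < r → (r ^ (-δ)) ^ β = r ^ (-(1 / 2) : ℝ) := fun {r} hr => by
    rw [← Real.rpow_natCast, ← Real.rpow_mul hr.le]
    congr 1
    rw [hδdef]
    field_simp
  have hgβ : Tendsto (fun r => (g r : ℝ) ^ β * (2 * r)) (𝓝[>] 0) (𝓝 0) := by
    have hlim := (tendsto_rpow_nhdsGT_zero (by norm_num : (0 : ℝ) < 1 / 2)).const_mul (2 ^ β * 2)
    rw [mul_zero] at hlim
    refine squeeze_zero' ?_ ?_ hlim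
    · filter_upwards [hsmall] with r hr
      have := hr.1
      positivity
    · filter_upwards [hsmall] with r hr
      have hr0 := hr.1
      calc (g r : ℝ) ^ β * (2 * r) ≤ (2 * r ^ (-δ)) ^ β * (2 * r) := by
            gcongr
            exact natCeil_rpow_neg_le hr.1 hr.2 hδ.le
        _ = 2 ^ β * 2 * (r ^ (-(1 / 2) : ℝ) * r) := by
            rw [mul_pow, hpow' hr0]
            ring
        _ = 2 ^ β * 2 * r ^ (1 / 2 : ℝ) := by
            rw [← Real.rpow_add_one hr0.ne']
            norm_num
  -- a polynomial lower bound `r ^ D` for the measure of balls dictates the other exponents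
  obtain ⟨s, hs⟩ := exists_nat_ge ((2 * D + 1) / p)
  have hsp : (2 * D + 1 : ℝ) ≤ s * p := (div_le_iff₀ hp).1 hs
  have hs1 : (2 * D + 1 : ℝ) ≤ s := hsp.trans (mul_le_of_le_one_right s.cast_nonneg hp1)
  obtain ⟨K, hK⟩ := exists_nat_ge ((b + (2 * D + 1)) / a)
  have hKa : b + (2 * D + 1) ≤ K * a := (div_le_iff₀ ha).1 hK
  obtain ⟨G, hG0, hG⟩ := hγ.exists_pow_mul_abs_le (2 * β * (K + s))
  have hpD : ∀ {r x : ℝ}, 0 < r → r ≤ 1 → (2 * D + 1 : ℝ) ≤ x → r ^ x ≤ r ^ (2 * D + 1) := by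
    intro r x hr hr1 hx
    rw [← Real.rpow_natCast r]
    exact Real.rpow_le_rpow_of_exponent_ge hr hr1 (by exact_mod_cast hx)
  have hW : ∀ {r : ℝ}, 0 < r → ∀ ℓ, g r ≤ ℓ → |γ ℓ| * (r ^ K)⁻¹ ≤ G * r ^ s := by
    intro r hr ℓ hℓ
    have h0 : r ^ (-δ) ≤ ℓ := (Nat.le_ceil _).trans (by exact_mod_cast hℓ)
    have h2 : (r ^ (K + s))⁻¹ ≤ (ℓ : ℝ) ^ (2 * β * (K + s)) := by
      rw [← inv_pow, ← hpow hr, ← pow_mul]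
      exact pow_le_pow_left₀ (by positivity) h0 _
    have h3 : (r ^ (K + s))⁻¹ * |γ ℓ| ≤ G :=
      (mul_le_mul_of_nonneg_right h2 (abs_nonneg _)).trans (hG ℓ)
    have h4 : |γ ℓ| ≤ G * r ^ (K + s) := by
      rwa [inv_mul_eq_div, div_le_iff₀ (by positivity)] at h3
    rw [← div_eq_mul_inv, div_le_iff₀ (by positivity), mul_assoc, ← pow_add, add_comm s]
    exact h4
  set K₀ := ∫ ω, |C ω| ^ p ∂P with hK₀
  have hK₀0 : 0 ≤ K₀ := integral_nonneg fun ω => Real.rpow_nonneg (abs_nonneg _) _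
  have hu : Tendsto (fun r => (g r : ℝ) * (c * r ^ d₀)) (𝓝[>] 0) (𝓝 0) := by
    have hlim := (tendsto_rpow_nhdsGT_zero (sub_pos.2 hδd)).const_mul (2 * c)
    rw [mul_zero] at hlim
    refine squeeze_zero' ?_ ?_ hlim
    · filter_upwards [hsmall] with r hr
      have := hr.1
      positivity
    · filter_upwards [hsmall] with r hr
      have hr0 := hr.1
      calc (g r : ℝ) * (c * r ^ d₀) ≤ 2 * r ^ (-δ) * (c * r ^ d₀) := by
            gcongr
            exact natCeil_rpow_neg_le hr.1 hr.2 hδ.le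
        _ = 2 * c * r ^ (d₀ - δ) := by
            rw [sub_eq_neg_add, Real.rpow_add hr0]
            ring
  have hv : Tendsto (fun r : ℝ => c * r ^ d₀) (𝓝[>] 0) (𝓝 0) := by
    simpa using (tendsto_rpow_nhdsGT_zero hd₀).const_mul c
  have hr : Tendsto (fun r : ℝ => r) (𝓝[>] 0) (𝓝 0) := tendsto_id.mono_left nhdsWithin_le_nhds
  have hrec := h1.exists_ae_pow_mul_dist_ge hR h2 hγ h5 hβd
  filter_upwards [hD (P.compProd κ).snd inferInstance,
    hR.ae_eventually_short_return_le ha h4 hrec hgβ] with y hyD hyσ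
  have hpos : ∀ r, 0 < r → 0 < (P.compProd κ).snd.real (Metric.ball y r) := by
    intro r hr
    obtain ⟨r', h1', hr'0, hr'⟩ := (hyD.and (Ioo_mem_nhdsGT hr)).exists
    exact (pow_pos hr'0 D).trans_le
      (h1'.trans (measureReal_mono (Metric.ball_subset_ball hr'.le)))
  refine ⟨hpos, fun t ht => ?_⟩
  rw [Metric.tendsto_nhds]
  intro e he
  have hη : 0 < e / 4 := by positivity
  have hη1 : 0 < e / (4 * (t + 1)) := by positivity
  have hΦ : Tendsto (fun r : ℝ => t * (g r * (c * r ^ d₀)) + t * (r * (1 + K₀ * G ^ p))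
      + t * (c * r ^ d₀) + (2 * (t * (g r * (c * r ^ d₀)))
        + t ^ 2 * (r * (2 + |C₀| * G + K₀ * G ^ p))) / (e / 4)) (𝓝[>] 0) (𝓝 0) := by
    have := (((hu.const_mul t).add ((hr.mul_const (1 + K₀ * G ^ p)).const_mul t)).add
      (hv.const_mul t)).add ((((hu.const_mul t).const_mul 2).add
        ((hr.mul_const (2 + |C₀| * G + K₀ * G ^ p)).const_mul (t ^ 2))).div_const (e / 4))
    simpa using this
  filter_upwards [hsmall, hyD, hyσ _ hη1, hΦ.eventually_lt_const hη] with r ⟨hr0, hr1⟩ hrD hrσ hrΦ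
  have hε := hpos r hr0
  have hmain := h3.integral_abs_noHit_sub_exp_le h1 hR hp hp1 hC (y := y) (r := r)
    (pow_pos hr0 K) (by positivity : 0 ≤ c * r ^ d₀) (h2.mono fun ω hω => hω y r hr0)
    (Nat.ceil_pos.2 (Real.rpow_pos_of_pos hr0 _) : 1 ≤ g r) hrσ
    (sub_le_iff_le_add'.2 (h4 y r (r ^ K) hr0 (pow_pos hr0 K))) (hW hr0) hη
    ⌊t / (P.compProd κ).snd.real (Metric.ball y r)⌋₊
  rw [← hK₀] at hmain
  set ε := (P.compProd κ).snd.real (Metric.ball y r)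
  have hnε : (⌊t / ε⌋₊ : ℝ) * ε ≤ t := by
    rw [← le_div_iff₀ hε]
    exact Nat.floor_le (by positivity)
  set n := ⌊t / ε⌋₊
  have hn0 : (0 : ℝ) ≤ n := n.cast_nonneg
  have hnD : (n : ℝ) * r ^ D ≤ t := (mul_le_mul_of_nonneg_left hrD hn0).trans hnε
  have hD0 : 0 ≤ (n : ℝ) * r ^ D := by positivity
  -- powers of `r` absorb the factors `n` and `n ^ 2`
  have hn2 : (n : ℝ) ^ 2 * r ^ (2 * D + 1) ≤ t ^ 2 * r := by
    calc (n : ℝ) ^ 2 * r ^ (2 * D + 1) = (n * r ^ D) ^ 2 * r := by ring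
      _ ≤ t ^ 2 * r := by gcongr
  have hn1 : (n : ℝ) * r ^ (2 * D + 1) ≤ t * r := by
    calc (n : ℝ) * r ^ (2 * D + 1) = (n * r ^ D) * (r ^ D * r) := by ring
      _ ≤ t * (1 * r) := by
          gcongr
          exact pow_le_one₀ hr0.le hr1
      _ = t * r := by ring
  have hα : r ^ (-b) * (r ^ K) ^ a ≤ r ^ (2 * D + 1) := by
    rw [← Real.rpow_natCast r K, ← Real.rpow_mul hr0.le, ← Real.rpow_add hr0]
    exact hpD hr0 hr1 (by linarith)
  have hWs : G * r ^ s ≤ G * r ^ (2 * D + 1) := by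
    rw [← Real.rpow_natCast r s]
    exact mul_le_mul_of_nonneg_left (hpD hr0 hr1 hs1) hG0
  have hWp : (G * r ^ s) ^ p ≤ G ^ p * r ^ (2 * D + 1) := by
    rw [Real.mul_rpow hG0 (by positivity), ← Real.rpow_natCast r s, ← Real.rpow_mul hr0.le]
    exact mul_le_mul_of_nonneg_left (hpD hr0 hr1 hsp) (by positivity)
  have hte : t * (e / (4 * (t + 1))) ≤ e / 4 := by
    rw [mul_div_assoc', div_le_div_iff₀ (by positivity) (by positivity)]
    linarith
  have herr := error_terms_le (C₀ := |C₀|) (s := e / (4 * (t + 1))) hn0 (g r).cast_nonneg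
    (by positivity : 0 ≤ c * r ^ d₀) (abs_nonneg C₀) hK₀0 hη1.le (by positivity) (by positivity) hη
    hnε hn1 hn2 hα hWs hWp
  rw [Real.dist_0_eq_abs, abs_of_nonneg (integral_nonneg fun ω => abs_nonneg _)]
  have hfin := hmain.trans (herr.trans (add_le_add_left (add_le_add_left hte _) _))
  refine hfin.trans_lt ?_
  linarith only [hrΦ, he]

end Scales

/-! ### Uniformity in time -/

section Uniform

/-- Pólya's argument: for a nonincreasing sequence, closeness to the exponential at finitely many
times gives closeness at all times. -/
lemma abs_sub_exp_le_of_antitone {v : ℕ → ℝ} (hv : Antitone v) (hv0 : ∀ n, 0 ≤ v n) {ε η : ℝ}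
    (hε : 0 < ε) (hη : 0 < η) (K n : ℕ) :
    |v n - Real.exp (-(n * ε))| ≤ η + ε + Real.exp (-(K * η))
      + ∑ k ∈ Finset.range (K + 1), |v ⌊k * η / ε⌋₊ - Real.exp (-(⌊k * η / ε⌋₊ * ε))| := by
  set D : ℕ → ℝ := fun k => |v ⌊k * η / ε⌋₊ - Real.exp (-(⌊k * η / ε⌋₊ * ε))| with hD
  have hDle : ∀ k ≤ K, D k ≤ ∑ k ∈ Finset.range (K + 1), D k := fun k hk =>
    Finset.single_le_sum (f := D) (fun _ _ => abs_nonneg _) (Finset.mem_range.2 (by omega))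
  have hfl : ∀ k : ℕ, (⌊k * η / ε⌋₊ : ℝ) * ε ≤ k * η ∧ k * η - ε ≤ (⌊k * η / ε⌋₊ : ℝ) * ε := by
    intro k
    constructor
    · rw [← le_div_iff₀ hε]
      exact Nat.floor_le (by positivity)
    · have := (div_lt_iff₀ hε).1 (Nat.lt_floor_add_one (k * η / ε))
      linarith
  have hmono : ∀ {x y : ℝ}, 0 ≤ x → x ≤ y → Real.exp (-y) ≤ Real.exp (-x) := fun _ h =>
    Real.exp_le_exp.2 (by linarith)
  have hlip : ∀ {x y : ℝ}, 0 ≤ x → 0 ≤ y → Real.exp (-x) - Real.exp (-y) ≤ |x - y| := fun hx hy =>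
    (le_abs_self _).trans (abs_exp_neg_sub_exp_neg_le hx hy)
  have hn0 : (0 : ℝ) ≤ n * ε := by positivity
  have hexp0 := Real.exp_pos (-(n * ε))
  have hexpK := Real.exp_pos (-(K * η))
  -- the last grid point before `n ε`
  have hlow : ∀ k : ℕ, k ≤ K → (k : ℝ) * η ≤ n * ε →
      v n ≤ Real.exp (-(⌊k * η / ε⌋₊ * ε)) + ∑ k ∈ Finset.range (K + 1), D k := by
    intro k hk hkn
    have h1 : v n ≤ v ⌊k * η / ε⌋₊ := hv (Nat.floor_le_of_le ((div_le_iff₀ hε).2 hkn))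
    have h2 : v ⌊k * η / ε⌋₊ - Real.exp (-(⌊k * η / ε⌋₊ * ε)) ≤ D k := le_abs_self _
    linarith [hDle k hk]
  rcases le_or_gt ((K : ℝ) * η) (n * ε) with hK | hK
  · have h1 := hlow K le_rfl hK
    have h2 := hlip (x := ⌊K * η / ε⌋₊ * ε) (y := K * η) (by positivity) (by positivity)
    have h3 : |(⌊K * η / ε⌋₊ : ℝ) * ε - K * η| ≤ ε := by
      rw [abs_le]
      constructor <;> linarith [hfl K]
    have h4 := hmono (by positivity) hK
    have h5 := hv0 n
    have h6 : 0 ≤ ∑ k ∈ Finset.range (K + 1), D k := Finset.sum_nonneg fun _ _ => abs_nonneg _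
    rw [abs_le]
    constructor <;> linarith
  · set k := ⌊n * ε / η⌋₊ with hk
    have hk1 : (k : ℝ) * η ≤ n * ε := by
      rw [← le_div_iff₀ hη]
      exact Nat.floor_le (by positivity)
    have hk2 : (n : ℝ) * ε < ((k + 1 : ℕ) : ℝ) * η := by
      rw [← div_lt_iff₀ hη]
      push_cast
      exact Nat.lt_floor_add_one _
    have hkK : k + 1 ≤ K := by
      have : (k : ℝ) < K := lt_of_mul_lt_mul_right (hk1.trans_lt hK) hη.le
      exact_mod_cast this
    have h1 := hlow k (by omega) hk1
    have h2 := hlip (x := ⌊k * η / ε⌋₊ * ε) (y := n * ε) (by positivity) hn0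
    have hk3 : ((k + 1 : ℕ) : ℝ) * η = k * η + η := by push_cast; ring
    have h3 : |(⌊k * η / ε⌋₊ : ℝ) * ε - n * ε| ≤ η + ε := by
      rw [abs_le]
      constructor <;> linarith [hfl k]
    -- the first grid point after `n ε`
    have h4 : v ⌊((k + 1 : ℕ) : ℝ) * η / ε⌋₊ ≤ v n :=
      hv (Nat.le_floor ((le_div_iff₀ hε).2 hk2.le))
    have h5 : Real.exp (-(⌊((k + 1 : ℕ) : ℝ) * η / ε⌋₊ * ε)) - D (k + 1)
        ≤ v ⌊((k + 1 : ℕ) : ℝ) * η / ε⌋₊ := by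
      have : -(v ⌊((k + 1 : ℕ) : ℝ) * η / ε⌋₊
          - Real.exp (-(⌊((k + 1 : ℕ) : ℝ) * η / ε⌋₊ * ε))) ≤ D (k + 1) := neg_le_abs _
      linarith
    have h6 := hmono (by positivity) (hfl (k + 1)).1
    have h7 := hlip hn0 (by positivity : (0 : ℝ) ≤ ((k + 1 : ℕ) : ℝ) * η)
    have h8 : |(n : ℝ) * ε - ((k + 1 : ℕ) : ℝ) * η| ≤ η := by
      rw [abs_le]
      constructor <;> linarith
    have h9 := hDle (k + 1) hkK
    rw [abs_le]
    constructor <;> linarith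

end Uniform

section Uniform

variable {Ω X : Type*} [MeasurableSpace Ω] [MetricSpace X] [CompactSpace X]
  [HasBesicovitchCovering X] [MeasurableSpace X] [BorelSpace X]
  {R : RandomSystem Ω X} {P : Measure Ω} [IsProbabilityMeasure P] {κ : Kernel Ω X}
  [IsMarkovKernel κ] {C : Ω → ℝ} {C₀ : ℝ} {γ : ℕ → ℝ} {c d₀ : ℝ}

/-- The exponential law for systems with everywhere measurable fibre maps. The error is the supremum
over the integer times, plus the rescaled time step. -/
lemma FiberedDecay.ae_exists_uniform_error (h3 : FiberedDecay R P κ C γ)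
    (h1 : AnnealedDecay R P κ (P.compProd κ).snd C₀ γ) (hR : R.IsStationary P κ) {p : ℝ}
    (hp : 0 < p) (hp1 : p ≤ 1) (hC : Integrable (fun ω => |C ω| ^ p) P) (hγ : SuperPolyDecay γ)
    (hd₀ : 0 < d₀) (h2 : UniformBallBound P κ c d₀) {a b : ℝ} (ha : 0 < a)
    (h4 : AnnulusRegular (P.compProd κ).snd a b)
    (h5 : ∀ᵐ z ∂(P.compProd κ), ∀ n : ℕ, 1 ≤ n → R.iter n z.1 z.2 ≠ z.2) :
    ∀ᵐ y ∂(P.compProd κ).snd, (∀ r, 0 < r → 0 < (P.compProd κ).snd.real (Metric.ball y r)) ∧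
      ∃ Δ : ℝ → Ω → ℝ, (∀ r, Measurable (Δ r)) ∧
        TendstoInMeasure P Δ (𝓝[>] 0) (fun _ => 0) ∧
        ∀ r, 0 < r → ∀ ω, ∀ t : ℝ, 0 ≤ t →
          |(κ ω).real (R.noHit (Metric.ball y r)
              ⌊t / (P.compProd κ).snd.real (Metric.ball y r)⌋₊ ω) - Real.exp (-t)| ≤ Δ r ω := by
  filter_upwards [h3.ae_tendsto_integral_abs_noHit_sub_exp h1 hR hp hp1 hC hγ hd₀ h2 ha h4 h5]
    with y ⟨hpos, hy⟩
  refine ⟨hpos, ?_⟩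
  set ε : ℝ → ℝ := fun r => (P.compProd κ).snd.real (Metric.ball y r) with hεdef
  set V : ℝ → ℕ → Ω → ℝ := fun r n ω => (κ ω).real (R.noHit (Metric.ball y r) n ω) with hV
  have hε0 : ∀ r, 0 ≤ ε r := fun r => measureReal_nonneg
  have mV : ∀ r n, Measurable (V r n) := fun r n => hR.measurable_real_noHit measurableSet_ball n
  have mF : ∀ r n, Measurable fun ω => |V r n ω - Real.exp (-(n * ε r))| := fun r n =>
    ((mV r n).sub_const _).abs
  have bF : ∀ r n ω, |V r n ω - Real.exp (-(n * ε r))| ≤ 1 := fun r n ω => by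
    have e1 : V r n ω ≤ 1 := measureReal_le_one
    have e2 : 0 ≤ V r n ω := measureReal_nonneg
    have e3 : Real.exp (-(n * ε r)) ≤ 1 :=
      Real.exp_le_one_iff.2 (neg_nonpos.2 (mul_nonneg n.cast_nonneg (hε0 r)))
    have e4 := Real.exp_pos (-(n * ε r))
    rw [abs_le]
    constructor <;> linarith
  have hbdd : ∀ r ω, BddAbove (Set.range fun n => |V r n ω - Real.exp (-(n * ε r))|) :=
    fun r ω => ⟨1, by rintro _ ⟨n, rfl⟩; exact bF r n ω⟩
  set Δ : ℝ → Ω → ℝ := fun r ω => (⨆ n, |V r n ω - Real.exp (-(n * ε r))|) + ε r with hΔ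
  have mΔ : ∀ r, Measurable (Δ r) := fun r => (Measurable.iSup (mF r)).add_const _
  have hΔ0 : ∀ r ω, 0 ≤ Δ r ω := fun r ω =>
    add_nonneg ((abs_nonneg _).trans (le_ciSup (hbdd r ω) 0)) (hε0 r)
  have hε1 : ∀ r, ε r ≤ 1 := fun r => measureReal_le_one
  have iΔ : ∀ r, Integrable (Δ r) P := fun r =>
    integrable_of_abs_le (B := 2) (mΔ r) fun ω => by
      rw [abs_of_nonneg (hΔ0 r ω)]
      have : (⨆ n, |V r n ω - Real.exp (-(n * ε r))|) ≤ 1 := ciSup_le fun n => bF r n ω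
      linarith [hε1 r]
  have iF : ∀ r n, Integrable (fun ω => |V r n ω - Real.exp (-(n * ε r))|) P := fun r n =>
    integrable_of_abs_le (B := 1) (mF r n) fun ω => by
      rw [abs_abs]
      exact bF r n ω
  have hεlim : Tendsto ε (𝓝[>] 0) (𝓝 0) := by
    have hlim := (tendsto_rpow_nhdsGT_zero hd₀).const_mul c
    rw [mul_zero] at hlim
    refine squeeze_zero' (Eventually.of_forall hε0) ?_ hlim
    filter_upwards [self_mem_nhdsWithin] with r hr
    exact h2.real_snd_ball_le y hr
  -- convergence in mean
  have hmean : Tendsto (fun r => ∫ ω, Δ r ω ∂P) (𝓝[>] 0) (𝓝 0) := by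
    rw [Metric.tendsto_nhds]
    intro e he
    obtain ⟨K, hK⟩ : ∃ K : ℕ, Real.exp (-(K * (e / 4))) < e / 4 := by
      have hlim : Tendsto (fun K : ℕ => Real.exp (-(K * (e / 4)))) atTop (𝓝 0) :=
        Real.tendsto_exp_neg_atTop_nhds_zero.comp
          (tendsto_natCast_atTop_atTop.atTop_mul_const (by positivity))
      exact (hlim.eventually_lt_const (by positivity)).exists
    have hgrid : Tendsto (fun r => 2 * ε r + ∑ k ∈ Finset.range (K + 1),
        ∫ ω, |V r ⌊k * (e / 4) / ε r⌋₊ ω - Real.exp (-(⌊k * (e / 4) / ε r⌋₊ * ε r))| ∂P)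
        (𝓝[>] 0) (𝓝 0) := by
      have := (hεlim.const_mul 2).add (tendsto_finsetSum (Finset.range (K + 1))
        fun k _ => hy (k * (e / 4)) (by positivity))
      rw [mul_zero, Finset.sum_const_zero, add_zero] at this
      exact this
    filter_upwards [hgrid.eventually_lt_const (by positivity : (0 : ℝ) < e / 4),
      self_mem_nhdsWithin] with r hr hr0
    have hpt : ∀ ω, Δ r ω ≤ (e / 4 + 2 * ε r + Real.exp (-(K * (e / 4))))
        + ∑ k ∈ Finset.range (K + 1),
          |V r ⌊k * (e / 4) / ε r⌋₊ ω - Real.exp (-(⌊k * (e / 4) / ε r⌋₊ * ε r))| := by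
      intro ω
      have hanti : Antitone fun n => V r n ω := fun m n hmn =>
        measureReal_mono (RandomSystem.noHit_antitone _ _ hmn)
      have : (⨆ n, |V r n ω - Real.exp (-(n * ε r))|) ≤ _ := ciSup_le fun n =>
        abs_sub_exp_le_of_antitone hanti (fun n => measureReal_nonneg) (hpos r hr0)
          (by positivity : (0 : ℝ) < e / 4) K n
      simp only [hΔ]
      linarith
    have iS : Integrable (fun ω => ∑ k ∈ Finset.range (K + 1),
        |V r ⌊k * (e / 4) / ε r⌋₊ ω - Real.exp (-(⌊k * (e / 4) / ε r⌋₊ * ε r))|) P :=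
      integrable_finsetSum _ fun k _ => iF r _
    have hle := integral_mono (iΔ r) ((integrable_const _).add iS) hpt
    rw [integral_add' (integrable_const _) iS, integral_finsetSum _ fun k _ => iF r _] at hle
    simp only [integral_const, probReal_univ, one_smul] at hle
    rw [Real.dist_0_eq_abs, abs_of_nonneg (integral_nonneg (hΔ0 r))]
    linarith
  refine ⟨Δ, mΔ, ?_, fun r hr ω t ht => ?_⟩
  · refine tendstoInMeasure_of_tendsto_eLpNorm one_ne_zero
      (fun r => (mΔ r).aestronglyMeasurable) aestronglyMeasurable_const ?_
    have heq : ∀ r, eLpNorm (Δ r - fun _ => 0) 1 P = ENNReal.ofReal (∫ ω, Δ r ω ∂P) := fun r => by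
      rw [eLpNorm_one_eq_lintegral_enorm,
        ofReal_integral_eq_lintegral_ofReal (iΔ r) (ae_of_all _ (hΔ0 r))]
      refine lintegral_congr fun ω => ?_
      rw [Pi.sub_apply, sub_zero, Real.enorm_of_nonneg (hΔ0 r ω)]
    simp only [heq]
    simpa using ENNReal.tendsto_ofReal hmean
  · have hε := hpos r hr
    have hfl1 : (⌊t / ε r⌋₊ : ℝ) * ε r ≤ t := by
      rw [← le_div_iff₀ hε]
      exact Nat.floor_le (by positivity)
    have hfl2 := (div_lt_iff₀ hε).1 (Nat.lt_floor_add_one (t / ε r))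
    have h1 := le_ciSup (hbdd r ω) ⌊t / ε r⌋₊
    have h2 := abs_exp_neg_sub_exp_neg_le (x := ⌊t / ε r⌋₊ * ε r) (by positivity) ht
    have h3 : |(⌊t / ε r⌋₊ : ℝ) * ε r - t| ≤ ε r := by
      rw [abs_le]
      constructor <;> linarith
    exact (abs_sub_le _ _ _).trans (add_le_add h1 (h2.trans h3))

end Uniform

/-! ### Extension of the fibre maps to everywhere measurable maps -/

namespace RandomSystem

section Totalize

variable {Ω X : Type*} [MeasurableSpace Ω] [MeasurableSpace X] (R : RandomSystem Ω X)

open Classical in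
/-- The fibre maps extended by the identity outside the fibres; unlike the original total maps, the
extended ones are measurable on all of `Ω × X`. -/
noncomputable def totalMap (ω : Ω) (x : X) : X := if x ∈ R.fiber ω then R.f ω x else x

variable {R}

lemma totalMap_of_mem {ω : Ω} {x : X} (hx : x ∈ R.fiber ω) : R.totalMap ω x = R.f ω x :=
  if_pos hx

lemma totalMap_of_notMem {ω : Ω} {x : X} (hx : x ∉ R.fiber ω) : R.totalMap ω x = x :=
  if_neg hx

variable (R)

lemma measurable_totalMap : Measurable fun z : Ω × X => R.totalMap z.1 z.2 := by
  refine measurable_of_restrict_of_restrict_compl R.measurableSet_graph ?_ ?_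
  · convert R.measurable_f using 1
    ext z
    exact totalMap_of_mem z.2
  · have : Measurable fun z : ({z : Ω × X | z.2 ∈ R.fiber z.1}ᶜ : Set (Ω × X)) => z.1.2 :=
      measurable_snd.comp measurable_subtype_coe
    convert this using 1
    ext z
    exact totalMap_of_notMem z.2

/-- The system with full fibres and the extended fibre maps. -/
noncomputable def totalize : RandomSystem Ω X where
  θ := R.θ
  fiber := fun _ => Set.univ
  f := R.totalMap
  measurableSet_graph := by simp
  mapsTo := fun _ _ _ => Set.mem_univ _
  measurable_f := R.measurable_totalMap.comp measurable_subtype_coe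

variable {R}

lemma totalize_iter_of_mem {ω : Ω} {x : X} (hx : x ∈ R.fiber ω) (k : ℕ) :
    R.totalize.iter k ω x = R.iter k ω x ∧ R.iter k ω x ∈ R.fiber (R.θ^[k] ω) := by
  induction k with
  | zero => exact ⟨rfl, hx⟩
  | succ k ih =>
    obtain ⟨h1, h2⟩ := ih
    rw [Function.iterate_succ_apply']
    refine ⟨?_, R.mapsTo _ h2⟩
    change R.totalMap (R.θ^[k] ω) (R.totalize.iter k ω x) = R.f (R.θ^[k] ω) (R.iter k ω x)
    rw [h1, totalMap_of_mem h2]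

lemma totalize_mem_noHit_iff {ω : Ω} {x : X} (hx : x ∈ R.fiber ω) {A : Set X} {m : ℕ} :
    x ∈ R.totalize.noHit A m ω ↔ x ∈ R.noHit A m ω := by
  simp only [noHit, Set.mem_ofPred_eq, (totalize_iter_of_mem hx _).1]

variable {P : Measure Ω} {κ : Kernel Ω X}

lemma IsInvariantProb.ae_mem_fiber (hν : R.IsInvariantProb (P.compProd κ)) :
    ∀ᵐ z ∂(P.compProd κ), z.2 ∈ R.fiber z.1 := hν.supported

lemma IsInvariantProb.isStationary_totalize (hν : R.IsInvariantProb (P.compProd κ))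
    (hθ : MeasurePreserving R.θ P P) : R.totalize.IsStationary P κ where
  measurable_uncurry := R.measurable_totalMap
  base := hθ
  invariant := by
    refine Eq.trans (Measure.map_congr ?_) hν.invariant
    filter_upwards [hν.ae_mem_fiber] with z hz
    exact Prod.ext rfl (totalMap_of_mem hz)

end Totalize

end RandomSystem

section Transfer

variable {Ω X : Type*} [MeasurableSpace Ω] [MetricSpace X] [MeasurableSpace X]
  {R : RandomSystem Ω X} {P : Measure Ω} [IsProbabilityMeasure P] {κ : Kernel Ω X}
  [IsMarkovKernel κ]

lemma AnnealedDecay.totalize {μ : Measure X} {C₀ : ℝ} {γ : ℕ → ℝ}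
    (h : AnnealedDecay R P κ μ C₀ γ) (hν : R.IsInvariantProb (P.compProd κ)) :
    AnnealedDecay R.totalize P κ μ C₀ γ := by
  intro ℓ φ ψ L M hℓ hφ hψ hM
  have heq : ∫ ω, ∫ x, φ x * ψ (R.totalize.iter ℓ ω x) ∂(κ ω) ∂P
      = ∫ ω, ∫ x, φ x * ψ (R.iter ℓ ω x) ∂(κ ω) ∂P := by
    refine integral_congr_ae ?_
    filter_upwards [Measure.ae_ae_of_ae_compProd hν.ae_mem_fiber] with ω hω
    refine integral_congr_ae ?_
    filter_upwards [hω] with x hx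
    rw [(RandomSystem.totalize_iter_of_mem hx ℓ).1]
  rw [heq]
  exact h ℓ φ ψ L M hℓ hφ hψ hM

lemma FiberedDecay.totalize {C : Ω → ℝ} {γ : ℕ → ℝ}
    (h : FiberedDecay R P κ C γ) (hν : R.IsInvariantProb (P.compProd κ)) :
    FiberedDecay R.totalize P κ C γ := by
  filter_upwards [h, Measure.ae_ae_of_ae_compProd hν.ae_mem_fiber] with ω h hω ℓ φ ψ L M hℓ hφ hψ hM
  have heq : ∫ x, φ x * ψ (R.totalize.iter ℓ ω x) ∂(κ ω)
      = ∫ x, φ x * ψ (R.iter ℓ ω x) ∂(κ ω) := by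
    refine integral_congr_ae ?_
    filter_upwards [hω] with x hx
    rw [(RandomSystem.totalize_iter_of_mem hx ℓ).1]
  rw [heq]
  exact h ℓ φ ψ L M hℓ hφ hψ hM

end Transfer

/-! ### The exponential law -/

theorem theorem2 {Ω X : Type*} [MeasurableSpace Ω]
    [MetricSpace X] [CompactSpace X] [HasBesicovitchCovering X]
    [MeasurableSpace X] [BorelSpace X]
    -- the random dynamical system over an ergodic invertible base
    (R : RandomSystem Ω X) (P : Measure Ω) [IsProbabilityMeasure P] (hθ : Ergodic R.θ P)
    -- the invariant measure, its sample measures `κ ω` and its marginal `μ` on `X`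
    (ν : Measure (Ω × X)) (hν : R.IsInvariantProb ν)
    (κ : Kernel Ω X) [IsMarkovKernel κ] (hκ : ν = P.compProd κ)
    (μ : Measure X) (hμ : μ = ν.snd)
    -- constants and rates
    (C₀ : ℝ) (γ : ℕ → ℝ) (hγ : SuperPolyDecay γ)
    (p : ℝ) (hp : 0 < p) (hp1 : p ≤ 1) (C : Ω → ℝ) (hC : MemLp C (ENNReal.ofReal p) P)
    (c d₀ : ℝ) (hd₀ : 0 < d₀) (a b : ℝ) (ha : 0 < a) (hb : 0 < b)
    -- hypotheses (I') to (V')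
    (h1 : AnnealedDecay R P κ μ C₀ γ)
    (h2 : ∀ᵐ z ∂ν, (d₀ : EReal) < lowerLocalDim μ z.2)
    (h2' : UniformBallBound P κ c d₀)
    (h3 : FiberedDecay R P κ C γ)
    (h4 : AnnulusRegular μ a b)
    (h5 : R.RandomAperiodic ν) :
    ∀ᵐ y ∂μ, ∃ Δ : ℝ → Ω → ℝ,
      (∀ r, 0 < r → Measurable (Δ r)) ∧
      TendstoInMeasure P Δ (𝓝[>] 0) (fun _ => 0) ∧
      ∀ r, 0 < r → ∀ ω, ∀ t : ℝ, 0 ≤ t →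
        |(κ ω).real {x | ENNReal.ofReal t / μ (Metric.ball y r)
            < (R.hitTime (Metric.ball y r) ω x : ℝ≥0∞)} - Real.exp (-t)| ≤ Δ r ω := by
  subst hμ
  subst hκ
  have hCi : Integrable (fun ω => |C ω| ^ p) P := by
    have := hC.integrable_norm_rpow (by simpa using hp) ENNReal.ofReal_ne_top
    simpa [ENNReal.toReal_ofReal hp.le] using this
  have h5' : ∀ᵐ z ∂(P.compProd κ), ∀ n : ℕ, 1 ≤ n → R.totalize.iter n z.1 z.2 ≠ z.2 := by
    have haper : ∀ᵐ z ∂(P.compProd κ),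
        ¬ (z ∈ R.graph ∧ ∃ n : ℕ, 1 ≤ n ∧ R.iter n z.1 z.2 = z.2) := by
      rw [ae_iff]
      simp only [not_not]
      exact h5
    filter_upwards [haper, hν.ae_mem_fiber] with z hz hzf n hn hper
    rw [(RandomSystem.totalize_iter_of_mem hzf n).1] at hper
    exact hz ⟨hzf, n, hn, hper⟩
  filter_upwards [(h3.totalize hν).ae_exists_uniform_error (h1.totalize hν)
    (hν.isStationary_totalize hθ.toMeasurePreserving) hp hp1 hCi hγ hd₀ h2' ha h4 h5']
    with y ⟨hpos, Δ, mΔ, hΔ, hbound⟩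
  -- the sample measures charge their fibres only for almost every `ω`; elsewhere the error is `1`
  have hmeas : MeasurableSet {ω | κ ω {x | (ω, x) ∈ R.graphᶜ} = 0} :=
    Kernel.measurable_kernel_prodMk_left R.measurableSet_graph.compl (measurableSet_singleton 0)
  have hae : ∀ᵐ ω ∂P, κ ω {x | (ω, x) ∈ R.graphᶜ} = 0 :=
    Measure.ae_ae_of_ae_compProd hν.ae_mem_fiber
  classical
  refine ⟨fun r ω => if κ ω {x | (ω, x) ∈ R.graphᶜ} = 0 then Δ r ω else 1,
    fun r _ => Measurable.ite hmeas (mΔ r) measurable_const, hΔ.congr_left fun r => ?_,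
    fun r hr ω t ht => ?_⟩
  · filter_upwards [hae] with ω hω
    rw [if_pos hω]
  · have hε := hpos r hr
    beta_reduce
    split_ifs with hω
    · convert hbound r hr ω t ht using 3
      refine measureReal_congr ?_
      have hfib : ∀ᵐ x ∂(κ ω), x ∈ R.fiber ω := hω
      filter_upwards [hfib] with x hx
      refine propext (Iff.trans ?_ (RandomSystem.totalize_mem_noHit_iff hx).symm)
      have hdiv : ENNReal.ofReal t / (P.compProd κ).snd (Metric.ball y r)
          = ENNReal.ofReal (t / (P.compProd κ).snd.real (Metric.ball y r)) := by
        rw [ENNReal.ofReal_div_of_pos hε, ofReal_measureReal]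
      rw [← RandomSystem.lt_hitTime_iff (div_nonneg ht hε.le), ← hdiv]
      rfl
    · rw [abs_le]
      have e1 : Real.exp (-t) ≤ 1 := Real.exp_le_one_iff.2 (by linarith)
      have e2 := Real.exp_pos (-t)
      constructor <;>
        linarith [(measureReal_le_one : (κ ω).real {x | ENNReal.ofReal t /
          (P.compProd κ).snd (Metric.ball y r) < (R.hitTime (Metric.ball y r) ω x : ℝ≥0∞)} ≤ 1),
          (measureReal_nonneg : 0 ≤ (κ ω).real {x | ENNReal.ofReal t /
          (P.compProd κ).snd (Metric.ball y r) < (R.hitTime (Metric.ball y r) ω x : ℝ≥0∞)})]
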